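/- Let $G$ be a finite simple graph with vertex set $V(G)$. Two adjacent vertices $u,v$ of $G$ are *twins* if $N_G(u)\setminus\{v\}=N_G(v)\setminus\{u\}$, and a *bubble* of $G$ is a maximal set of pairwise twins (possibly a single vertex). A *bubble partition* of $G$ is a partition $\mathcal V=\{V_1,\dots,V_k\}$ of $V(G)$ such that every $V_i$ is a union of bubbles and the simple graph obtained from $G$ by contracting (identifying) every $V_i$ to a single vertex is a tree. Let $\alpha(\mathcal V)$ be the maximum over $i$ of the independence number of the induced subgraph $G[V_i]$, and let $w(\mathcal V)$ be the maximum over $i$ of the number of bubbles contained in $V_i$. For $S\subseteq V(G)$, the cut size of $S$ is the number of edges of $G$ with exactly one endpoint in $S$, and $S$ is a *maximum cut* if its cut size is largest among all subsets of $V(G)$. **Theorem.** Given a bubble partition $\mathcal V$ of a graph $G$, a maximum cut of $G$ can be computed in time $O^*\!\left(|V(G)|^{4\alpha(\mathcal V)}\cdot 4^{w(\mathcal V)}\right)$, where $O^*$ suppresses factors polynomial in $|V(G)|$. That is, there are a single program for a random access machine (with logarithmic cost) and a polynomial $p$ such that, for every graph $G$ with vertices numbered $0,\dots,|V(G)|-1$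 and every bubble partition $\mathcal V$ of $G$, the program, given the adjacency matrix of $G$ and for every vertex a label in $\{0,\dots,|V(G)|-1\}$ identifying its part of $\mathcal V$, halts after time at most $p(|V(G)|)\cdot|V(G)|^{4\alpha(\mathcal V)}\cdot 4^{w(\mathcal V)}$ and outputs the characteristic vector of a maximum cut of $G$. -/

import Mathlib

/-! ## Bubbles, bubble partitions and cuts -/

namespace BubbleCut

/-- Two vertices are (true) twins if they are adjacent and have the same neighbours apart from
each other. -/
def AreTwins {V : Type*} (G : SimpleGraph V) (u v : V) : Prop :=
  G.Adj u v ∧ G.neighborSet u \ {v} = G.neighborSet v \ {u}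

/-- A bubble is a maximal set of pairwise twins. -/
def IsBubble {V : Type*} (G : SimpleGraph V) (B : Finset V) : Prop :=
  Maximal (fun U : Finset V => (U : Set V).Pairwise (AreTwins G)) B

/-- The simple graph obtained from `G` by contracting (identifying) every part of `P` to a single
vertex. -/
def contract {V : Type*} [Fintype V] [DecidableEq V] (G : SimpleGraph V)
    (P : Finpartition (Finset.univ : Finset V)) : SimpleGraph {A : Finset V // A ∈ P.parts} where
  Adj A B := A ≠ B ∧ ∃ u ∈ A.1, ∃ v ∈ B.1, G.Adj u v
  symm := ⟨fun _ _ ⟨hne, u, hu, v, hv, huv⟩ => ⟨hne.symm, v, hv, u, hu, huv.symm⟩⟩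
  loopless := ⟨fun _ h => h.1 rfl⟩

/-- A bubble partition of `G`: every part is a union of bubbles, and contracting every part to a
single vertex yields a tree. -/
def IsBubblePartition {V : Type*} [Fintype V] [DecidableEq V] (G : SimpleGraph V)
    (P : Finpartition (Finset.univ : Finset V)) : Prop :=
  (∀ A ∈ P.parts, ∃ F : Finset (Finset V), (∀ B ∈ F, IsBubble G B) ∧ A = F.biUnion id) ∧
    (contract G P).IsTree

/-- The independence number of a partition: the largest independence number of the subgraph
induced by a part. -/
noncomputable def independenceNumber {V : Type*} [Fintype V] [DecidableEq V] (G : SimpleGraph V)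
    (P : Finpartition (Finset.univ : Finset V)) : ℕ :=
  P.parts.sup fun A => (G.induce (A : Set V)).indepNum

/-- The width of a partition: the largest number of bubbles in a part. -/
noncomputable def width {V : Type*} [Fintype V] [DecidableEq V] (G : SimpleGraph V)
    (P : Finpartition (Finset.univ : Finset V)) : ℕ :=
  P.parts.sup fun A => {B : Finset V | IsBubble G B ∧ B ⊆ A}.ncard

/-- The cut-set of `S`: the edges with exactly one endpoint in `S`. -/
def cutSet {V : Type*} (G : SimpleGraph V) (S : Finset V) : Set (Sym2 V) :=
  {e | e ∈ G.edgeSet ∧ ∃ u ∈ S, ∃ v ∉ S, e = s(u, v)}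

/-- The cut size of `S`. -/
noncomputable def cutSize {V : Type*} (G : SimpleGraph V) (S : Finset V) : ℕ :=
  (cutSet G S).ncard

/-- `S` is a maximum (cardinality) cut of `G`. -/
def IsMaximumCut {V : Type*} (G : SimpleGraph V) (S : Finset V) : Prop :=
  ∀ S' : Finset V, cutSize G S' ≤ cutSize G S

end BubbleCut

/-! ## Random access machines with logarithmic cost

The memory consists of unbounded arrays of natural numbers. An array is named by a constant of the
program, so that a program uses only finitely many of them; cells are addressed by computed
indices. Every operation is charged one unit plus the bit lengths of the numbers it handles, indices
included. -/

namespace RAM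

/-- `m a i` is the content of cell `i` of array `a`. -/
abbrev Memory : Type := ℕ → ℕ → ℕ

/-- The arithmetic operations. -/
inductive Op : Type
  | add
  | sub
  | mul
  | div

/-- Subtraction is truncated at zero, division is rounded down. -/
def Op.eval : Op → ℕ → ℕ → ℕ
  | .add, x, y => x + y
  | .sub, x, y => x - y
  | .mul, x, y => x * y
  | .div, x, y => x / y

/-- Expressions: constants, cells of arrays, and arithmetic operations. -/
inductive Expr : Type
  | const (k : ℕ)
  | cell (a : ℕ) (i : Expr)
  | op (o : Op) (x y : Expr)

/-- The value of an expression. -/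
def Expr.eval (m : Memory) : Expr → ℕ
  | .const k => k
  | .cell a i => m a (i.eval m)
  | .op o x y => o.eval (x.eval m) (y.eval m)

/-- The logarithmic cost of evaluating an expression. -/
def Expr.cost (m : Memory) : Expr → ℕ
  | .const k => 1 + k.size
  | .cell a i => i.cost m + (1 + (i.eval m).size + (m a (i.eval m)).size)
  | .op _ x y => x.cost m + y.cost m + (1 + (x.eval m).size + (y.eval m).size)

/-- Programs. `write a i x` stores the value of `x` in cell `i` of array `a`; a test succeeds if
its value is nonzero. -/
inductive Program : Type
  | skip
  | write (a : ℕ) (i x : Expr)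
  | seq (p q : Program)
  | ite (b : Expr) (p q : Program)
  | while (b : Expr) (p : Program)

/-- The memory after storing `x` in cell `i` of array `a`. -/
def Memory.set (m : Memory) (a i x : ℕ) : Memory :=
  fun a' i' => if a' = a ∧ i' = i then x else m a' i'

/-- `Runs p m m' t`: started on the memory `m`, the program `p` halts with memory `m'` after time
exactly `t`. -/
inductive Runs : Program → Memory → Memory → ℕ → Prop
  | skip (m : Memory) : Runs .skip m m 1
  | write (a : ℕ) (i x : Expr) (m : Memory) :
      Runs (.write a i x) m (m.set a (i.eval m) (x.eval m))
        (i.cost m + x.cost m + (1 + (i.eval m).size + (x.eval m).size))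
  | seq {p q : Program} {m₁ m₂ m₃ : Memory} {t₁ t₂ : ℕ} :
      Runs p m₁ m₂ t₁ → Runs q m₂ m₃ t₂ → Runs (.seq p q) m₁ m₃ (t₁ + t₂)
  | ite_true {b : Expr} {p q : Program} {m m' : Memory} {t : ℕ} :
      b.eval m ≠ 0 → Runs p m m' t → Runs (.ite b p q) m m' (b.cost m + 1 + t)
  | ite_false {b : Expr} {p q : Program} {m m' : Memory} {t : ℕ} :
      b.eval m = 0 → Runs q m m' t → Runs (.ite b p q) m m' (b.cost m + 1 + t)
  | while_true {b : Expr} {p : Program} {m₁ m₂ m₃ : Memory} {t₁ t₂ : ℕ} :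
      b.eval m₁ ≠ 0 → Runs p m₁ m₂ t₁ → Runs (.while b p) m₂ m₃ t₂ →
        Runs (.while b p) m₁ m₃ (b.cost m₁ + 1 + t₁ + t₂)
  | while_false {b : Expr} {p : Program} {m : Memory} :
      b.eval m = 0 → Runs (.while b p) m m (b.cost m + 1)

end RAM

/-! ## Input and output -/

namespace BubbleCut

/-- A labelling of the vertices that represents the partition `P`: two vertices have the same label
if and only if they lie in the same part. -/
def IsLabelling {n : ℕ} (P : Finpartition (Finset.univ : Finset (Fin n)))
    (c : Fin n → Fin n) : Prop :=
  ∀ u v : Fin n, c u = c v ↔ ∃ A ∈ P.parts, u ∈ A ∧ v ∈ A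

open Classical in
/-- The input memory: cell `0` of array `0` holds the number `n` of vertices, array `1` holds the
adjacency matrix of `G`, row by row, and array `2` holds the label of each vertex. All other cells
hold `0`. -/
noncomputable def inputMemory {n : ℕ} (G : SimpleGraph (Fin n)) (c : Fin n → Fin n) : RAM.Memory
  | 0, i => if i = 0 then n else 0
  | 1, i => if ∃ u v : Fin n, G.Adj u v ∧ i = u.val * n + v.val then 1 else 0
  | 2, i => if h : i < n then (c ⟨i, h⟩).val else 0
  | _, _ => 0

/-- The output convention: array `3` holds the characteristic vector of `S`. -/
def IsOutput {n : ℕ} (m : RAM.Memory) (S : Finset (Fin n)) : Prop :=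
  ∀ v : Fin n, m 3 v.val = if v ∈ S then 1 else 0

end BubbleCut

/-!
Two exchange arguments restrict the shape of a maximum cut. Exchanging two twins is an automorphism
of the graph, so that only the number of chosen vertices of every bubble matters, and a cut may be
assumed to contain an initial segment of every bubble. If a cut splits two different bubbles that
are adjacent, hence completely joined to each other, then the cut size is an affine function along
the shifts of a vertex from one bubble to the other, so both shifts of a maximum cut are again
maximum; on the other hand the number of split pairs of twins is strictly concave along these
shifts, so one of them has fewer split pairs (`cutValue_shift_add_cutValue_shift`). A maximum cut
that is lexicographically minimal with respect to this number and to the sum of its vertices is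
therefore canonical: no two different split bubbles are adjacent
(`exists_isCanonical_forall_cutValue_le`).

The trace of a canonical set on a part is determined by the bubbles that it meets and by the first
missing vertex of every bubble that it splits. The missing vertices form an independent set, so a
part has at most `2 ^ w * (n ^ α + 1)` traces, for width `w` and independence number `α`
(`card_le_stateBound`). They are listed by adding the vertices one at a time and discarding the sets
that are not canonical.

The tree is then contracted edge by edge. For every remaining part `A`, which stands for the union
`U` of the parts merged into it, there is a list with a subset of `U` of largest cut size among
those with a given canonical trace on `A`. A leaf is merged into its neighbour by joining every set
in the list of the neighbour with the best set in the list of the leaf. The cut size of a disjoint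
union is the sum of the cut sizes minus twice the number of edges in between, and these edges see
only the traces on the two parts (`cutValue_union`, `IsPartialSolution.merge`), so it does not
matter that the cut size is taken in the whole graph rather than in `U`. A merge takes time
polynomial in `n` times the product of the lengths of two lists, which gives the bound.

Running times are counted in elementary steps by the predicate `HaltsIn`. Sets of vertices are
stored as numbers with at most `n` binary digits, and all stored numbers are at most
`2 ^ (4 * n + 4)`, so an elementary step has a logarithmic cost of `O(n)`.
-/

/-! ### A program logic with running times -/

namespace RAM

/-- A bound for the growth of an expression: on a memory with entries at most `M`, both the bit
length of the value of `e` and the cost of evaluating `e` are at most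
`e.weight * (M.size + 1)`. -/
def Expr.weight : Expr → ℕ
  | .const k => 1 + k.size
  | .cell _ i => 2 * i.weight + 2
  | .op _ x y => 2 * x.weight + 2 * y.weight + 1

/-- All entries of the memory `m` are at most `M`. -/
def Bounded (M : ℕ) (m : Memory) : Prop := ∀ a i, m a i ≤ M

theorem Op.size_eval_le (o : Op) (x y : ℕ) : (o.eval x y).size ≤ x.size + y.size + 1 := by
  have hx : x < 2 ^ x.size := Nat.lt_size_self x
  have hy : y < 2 ^ y.size := Nat.lt_size_self y
  have h1 : 2 ^ x.size ≤ 2 ^ (x.size + y.size) := Nat.pow_le_pow_right (by norm_num) (by omega)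
  have h2 : 2 ^ y.size ≤ 2 ^ (x.size + y.size) := Nat.pow_le_pow_right (by norm_num) (by omega)
  rw [Nat.size_le, pow_succ]
  cases o with
  | add => simp only [Op.eval]; omega
  | sub => simp only [Op.eval]; omega
  | mul =>
    simp only [Op.eval]
    have := Nat.mul_lt_mul'' hx hy
    rw [← pow_add] at this
    omega
  | div =>
    simp only [Op.eval]
    have := Nat.div_le_self x y
    omega

theorem Expr.size_eval_le_and_cost_le {M : ℕ} {m : Memory} (hm : Bounded M m) (e : Expr) :
    (e.eval m).size ≤ e.weight * (M.size + 1) ∧ e.cost m ≤ e.weight * (M.size + 1) := by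
  induction e with
  | const k =>
    simp only [Expr.eval, Expr.cost, Expr.weight]
    constructor <;> nlinarith [Nat.zero_le (k.size * M.size), Nat.zero_le M.size]
  | cell a i ih =>
    simp only [Expr.eval, Expr.cost, Expr.weight]
    have h := Nat.size_le_size (hm a (i.eval m))
    constructor <;> nlinarith [ih.1, ih.2, Nat.zero_le (i.weight * (M.size + 1))]
  | op o x y ihx ihy =>
    simp only [Expr.eval, Expr.cost, Expr.weight]
    have h := o.size_eval_le (x.eval m) (y.eval m)
    constructor <;> nlinarith [ihx.1, ihx.2, ihy.1, ihy.2, Nat.zero_le (x.weight * (M.size + 1)),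
      Nat.zero_le (y.weight * (M.size + 1))]

/-- A bound, up to the factor `M.size + 1`, for the logarithmic cost of an elementary step of the
program on memories with entries at most `M`. -/
def Program.weight : Program → ℕ
  | .skip => 1
  | .write _ i x => 2 * i.weight + 2 * x.weight + 1
  | .seq p q => p.weight + q.weight
  | .ite b p q => b.weight + 1 + p.weight + q.weight
  | .while b p => b.weight + 1 + p.weight

/-- `HaltsIn M p m T Q`: started on the memory `m` with entries at most `M`, the program `p` halts
after at most `T` elementary steps on a memory that satisfies `Q` and again has entries at most
`M`. An elementary step is charged `p.weight * (M.size + 1)` units of time. -/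
def HaltsIn (M : ℕ) (p : Program) (m : Memory) (T : ℕ) (Q : Memory → Prop) : Prop :=
  Bounded M m → ∃ m' t, Runs p m m' t ∧ t ≤ p.weight * (M.size + 1) * T ∧ Bounded M m' ∧ Q m'

variable {M : ℕ}

theorem HaltsIn.mono {p : Program} {m : Memory} {T T' : ℕ} {Q Q' : Memory → Prop}
    (h : HaltsIn M p m T Q) (hT : T ≤ T') (hQ : ∀ m', Q m' → Q' m') : HaltsIn M p m T' Q' := by
  intro hm
  obtain ⟨m', t, h1, h2, h3, h4⟩ := h hm
  exact ⟨m', t, h1, h2.trans (Nat.mul_le_mul_left _ hT), h3, hQ _ h4⟩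

theorem HaltsIn.skip {m : Memory} {Q : Memory → Prop} (h : Q m) :
    HaltsIn M .skip m 1 Q := by
  intro hm
  refine ⟨m, 1, .skip m, ?_, hm, h⟩
  simp [Program.weight]

theorem HaltsIn.write {a : ℕ} {i x : Expr} {m : Memory} {Q : Memory → Prop}
    (hx : x.eval m ≤ M) (h : Q (m.set a (i.eval m) (x.eval m))) :
    HaltsIn M (.write a i x) m 1 Q := by
  intro hm
  refine ⟨_, _, .write a i x m, ?_, ?_, h⟩
  · have h1 := Expr.size_eval_le_and_cost_le hm i
    have h2 := Expr.size_eval_le_and_cost_le hm x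
    simp only [Program.weight]
    nlinarith
  · intro a' i'
    unfold Memory.set
    split_ifs
    exacts [hx, hm _ _]

theorem HaltsIn.seq {p q : Program} {m : Memory} {T₁ T₂ : ℕ} {Q : Memory → Prop}
    (h : HaltsIn M p m T₁ fun m' => HaltsIn M q m' T₂ Q) :
    HaltsIn M (.seq p q) m (T₁ + T₂) Q := by
  intro hm
  obtain ⟨m₁, t₁, h1, h2, h3, h4⟩ := h hm
  obtain ⟨m₂, t₂, h5, h6, h7, h8⟩ := h4 h3
  refine ⟨m₂, t₁ + t₂, .seq h1 h5, ?_, h7, h8⟩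
  simp only [Program.weight]
  nlinarith [Nat.zero_le (p.weight * (M.size + 1) * T₂), Nat.zero_le (q.weight * (M.size + 1) * T₁)]

theorem HaltsIn.ite {b : Expr} {p q : Program} {m : Memory} {T : ℕ} {Q : Memory → Prop}
    (hp : b.eval m ≠ 0 → HaltsIn M p m T Q) (hq : b.eval m = 0 → HaltsIn M q m T Q) :
    HaltsIn M (.ite b p q) m (T + 1) Q := by
  intro hm
  have hb := (Expr.size_eval_le_and_cost_le hm b).2
  by_cases h : b.eval m = 0
  · obtain ⟨m₁, t₁, h1, h2, h3, h4⟩ := hq h hm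
    refine ⟨m₁, _, .ite_false h h1, ?_, h3, h4⟩
    simp only [Program.weight]
    nlinarith [Nat.zero_le (b.weight * (M.size + 1) * T), Nat.zero_le (p.weight * (M.size + 1) * T),
      Nat.zero_le (p.weight * (M.size + 1)), Nat.zero_le (q.weight * (M.size + 1)),
      Nat.zero_le ((M.size + 1) * T)]
  · obtain ⟨m₁, t₁, h1, h2, h3, h4⟩ := hp h hm
    refine ⟨m₁, _, .ite_true h h1, ?_, h3, h4⟩
    simp only [Program.weight]
    nlinarith [Nat.zero_le (b.weight * (M.size + 1) * T), Nat.zero_le (q.weight * (M.size + 1) * T),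
      Nat.zero_le (p.weight * (M.size + 1)), Nat.zero_le (q.weight * (M.size + 1)),
      Nat.zero_le ((M.size + 1) * T)]

/-- A loop that terminates after `N` rounds, by an invariant. -/
theorem HaltsIn.while {b : Expr} {p : Program} {N T : ℕ} (I : ℕ → Memory → Prop)
    {Q : Memory → Prop}
    (hb : ∀ k < N, ∀ m, I k m → b.eval m ≠ 0 ∧ HaltsIn M p m T (I (k + 1)))
    (hN : ∀ m, I N m → b.eval m = 0 ∧ Q m) :
    ∀ (k : ℕ) (m : Memory), k ≤ N → I k m → HaltsIn M (.while b p) m ((N - k) * (T + 1) + 1) Q := by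
  intro k m hk hI hm
  have hc := (Expr.size_eval_le_and_cost_le hm b).2
  have hw : (Program.while b p).weight = b.weight + 1 + p.weight := rfl
  induction hj : N - k generalizing k m with
  | zero =>
    obtain rfl : k = N := by omega
    obtain ⟨h1, h2⟩ := hN m hI
    refine ⟨m, _, .while_false h1, ?_, hm, h2⟩
    rw [hw]
    nlinarith [Nat.zero_le (p.weight * (M.size + 1))]
  | succ j ih =>
    obtain ⟨h1, h2⟩ := hb k (by omega) m hI
    obtain ⟨m₁, t₁, h3, h4, h5, h6⟩ := h2 hm
    obtain ⟨m₂, t₂, h7, h8, h9, h10⟩ := ih (k + 1) m₁ (by omega) h6 h5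
      (Expr.size_eval_le_and_cost_le h5 b).2 (by omega)
    refine ⟨m₂, _, .while_true h1 h3 h7, ?_, h9, h10⟩
    rw [hw] at h8 ⊢
    have e : (b.weight + 1 + p.weight) * (M.size + 1) * ((j + 1) * (T + 1) + 1)
      = (b.weight + 1 + p.weight) * (M.size + 1) * (j * (T + 1) + 1)
        + (b.weight + 1) * (M.size + 1) * (T + 1) + p.weight * (M.size + 1) * T
        + p.weight * (M.size + 1) := by ring
    rw [e]
    nlinarith [Nat.zero_le ((b.weight + 1) * (M.size + 1) * T), Nat.zero_le (p.weight * (M.size + 1))]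

/-- The content of the register `a`, that is, of cell `0` of array `a`. -/
abbrev reg (a : ℕ) : Expr := .cell a (.const 0)

/-- `setReg a x` stores the value of `x` in the register `a`. -/
abbrev setReg (a : ℕ) (x : Expr) : Program := .write a (.const 0) x

/-- `for x = 0, …, e - 1 do p`, with the counter in the register `x`. -/
def forLoop (x : ℕ) (e : Expr) (p : Program) : Program :=
  .seq (setReg x (.const 0)) (.while (.op .sub e (reg x))
    (.seq p (setReg x (.op .add (reg x) (.const 1)))))

theorem Memory.set_self (m : Memory) (a i x : ℕ) : m.set a i x a i = x := by
  simp [Memory.set]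

theorem Memory.set_of_ne (m : Memory) {a a' : ℕ} (h : a' ≠ a) (i x : ℕ) : m.set a i x a' = m a' := by
  funext j
  simp [Memory.set, h]

theorem HaltsIn.forLoop {x : ℕ} {e : Expr} {p : Program} {m : Memory} {N T : ℕ}
    (I : ℕ → Memory → Prop) {Q : Memory → Prop} (hN : N ≤ M) (h0 : I 0 (m.set x 0 0))
    (he : ∀ k ≤ N, ∀ m, I k m → m x 0 = k → e.eval m = N)
    (hb : ∀ k < N, ∀ m, m x 0 = k → I k m →
      HaltsIn M p m T fun m' => m' x 0 = k ∧ I (k + 1) (m'.set x 0 (k + 1)))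
    (hQ : ∀ m, m x 0 = N → I N m → Q m) :
    HaltsIn M (forLoop x e p) m (N * (T + 2) + 2) Q := by
  have key := HaltsIn.while (M := M) (b := .op .sub e (reg x))
    (p := .seq p (setReg x (.op .add (reg x) (.const 1)))) (N := N) (T := T + 1)
    (fun k m => m x 0 = k ∧ I k m) (Q := Q) ?_ ?_ 0 (m.set x 0 0) (Nat.zero_le _)
    ⟨Memory.set_self _ _ _ _, h0⟩
  · refine HaltsIn.mono (T := 1 + (N * (T + 2) + 1)) (HaltsIn.seq (HaltsIn.write (by simp [Expr.eval]) ?_))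
      (by omega) (fun _ h => h)
    simpa [Expr.eval] using key
  · rintro k hk m ⟨h1, h2⟩
    refine ⟨?_, HaltsIn.seq ((hb k hk m h1 h2).mono le_rfl ?_)⟩
    · simp only [Expr.eval, Op.eval, he k hk.le m h2 h1, h1]
      omega
    · rintro m' ⟨h3, h4⟩
      refine HaltsIn.write ?_ ?_
      · simp only [Expr.eval, Op.eval, h3]; omega
      · simp only [Expr.eval, Op.eval, h3]
        exact ⟨Memory.set_self _ _ _ _, h4⟩
  · rintro m ⟨h1, h2⟩
    exact ⟨by simp [Expr.eval, Op.eval, he N le_rfl m h2 h1, h1], hQ m h1 h2⟩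

/-- The memories `m` and `m'` agree, except possibly in the arrays of `F`. -/
def AgreeOff (F : Finset ℕ) (m m' : Memory) : Prop := ∀ a, a ∉ F → m' a = m a

theorem AgreeOff.refl (F : Finset ℕ) (m : Memory) : AgreeOff F m m := fun _ _ => rfl

theorem AgreeOff.trans {F : Finset ℕ} {m₁ m₂ m₃ : Memory} (h : AgreeOff F m₁ m₂)
    (h' : AgreeOff F m₂ m₃) : AgreeOff F m₁ m₃ := fun a ha => (h' a ha).trans (h a ha)

theorem AgreeOff.mono {F F' : Finset ℕ} {m m' : Memory} (h : AgreeOff F m m') (hF : F ⊆ F') :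
    AgreeOff F' m m' := fun a ha => h a fun h' => ha (hF h')

theorem AgreeOff.set {F : Finset ℕ} {m m' : Memory} (h : AgreeOff F m m') {a : ℕ} (ha : a ∈ F)
    (i x : ℕ) : AgreeOff F m (m'.set a i x) := by
  intro b hb
  have hba : b ≠ a := by
    rintro rfl
    exact hb ha
  rw [Memory.set_of_ne _ hba]
  exact h b hb

/-- The program `p` adds `v` to the register `s` within `T` steps, and changes no array outside
`F` otherwise. -/
def Adds (M s : ℕ) (F : Finset ℕ) (p : Program) (m : Memory) (v T : ℕ) : Prop :=
  m s 0 + v ≤ M → HaltsIn M p m T fun m' => m' s 0 = m s 0 + v ∧ AgreeOff F m m'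

/-- A loop that sums up a function over `Fin n`, provided that the register `0` holds `n`. -/
theorem Adds.forLoop {s x n T : ℕ} {F : Finset ℕ} {p : Program} {m : Memory} {g : Fin n → ℕ}
    (hs : s ∈ F) (hx : x ∉ F) (h0 : (0 : ℕ) ∉ insert x F) (hm : m 0 0 = n) (hn : n ≤ M)
    (hp : ∀ (u : Fin n) (m' : Memory), AgreeOff (insert x F) m m' → m' x 0 = u →
      Adds M s F p m' (g u) T) :
    Adds M s (insert x F) (forLoop x (reg 0) p) m (∑ u, g u) (n * (T + 2) + 2) := by
  intro hv
  have hxs : s ≠ x := fun e => hx (e ▸ hs)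
  have hsum : ∀ k ≤ n, (∑ u : Fin n with u.val < k, g u) ≤ ∑ u, g u := fun k _ =>
    Finset.sum_le_sum_of_subset (Finset.filter_subset _ _)
  refine HaltsIn.forLoop (N := n)
    (fun k m' => m' s 0 = m s 0 + ∑ u : Fin n with u.val < k, g u ∧ AgreeOff (insert x F) m m')
    hn ?_ ?_ ?_ ?_
  · refine ⟨?_, (AgreeOff.refl _ _).set (by simp) _ _⟩
    rw [Memory.set_of_ne _ hxs]
    simp
  · rintro k - m' ⟨-, h⟩ -
    simp [Expr.eval, h 0 h0, hm]
  · rintro k hk m' hmx ⟨h1, h2⟩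
    have hstep : (∑ u : Fin n with u.val < k + 1, g u)
        = (∑ u : Fin n with u.val < k, g u) + g ⟨k, hk⟩ := by
      have : (Finset.univ.filter fun u : Fin n => u.val < k + 1)
          = insert ⟨k, hk⟩ (Finset.univ.filter fun u : Fin n => u.val < k) := by
        ext u
        simp [Fin.ext_iff]
        omega
      rw [this, Finset.sum_insert (by simp), add_comm]
    refine (hp ⟨k, hk⟩ m' h2 hmx ?_).mono le_rfl ?_
    · have := hsum (k + 1) hk
      omega
    · rintro m'' ⟨h3, h4⟩
      refine ⟨by rw [h4 x hx, hmx], ?_, ?_⟩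
      · rw [Memory.set_of_ne _ hxs, h3, h1, hstep]
        ring
      · exact (h2.trans (h4.mono (Finset.subset_insert _ _))).set (by simp) _ _
  · rintro m' - ⟨h1, h2⟩
    refine ⟨?_, h2⟩
    rw [h1]
    congr 1
    exact Finset.sum_congr (by ext; simp) fun _ _ => rfl

/-- `s := s + e`. -/
abbrev increase (s : ℕ) (e : Expr) : Program := setReg s (.op .add (reg s) e)

theorem Adds.increase {s v : ℕ} {e : Expr} {m : Memory} (h : e.eval m = v) :
    Adds M s {s} (increase s e) m v 1 := by
  intro hv
  refine HaltsIn.write ?_ ⟨?_, (AgreeOff.refl _ _).set (by simp) _ _⟩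
  · simpa [Expr.eval, Op.eval, h] using hv
  · simp [Expr.eval, Op.eval, h, Memory.set]

/-- `s := ∑ x < n, e`, where `n` is the content of the register `0`. -/
def sumProg₁ (s x : ℕ) (e : Expr) : Program :=
  .seq (setReg s (.const 0)) (forLoop x (reg 0) (increase s e))

/-- `s := ∑ x < n, ∑ y < n, e`. -/
def sumProg₂ (s x y : ℕ) (e : Expr) : Program :=
  .seq (setReg s (.const 0)) (forLoop x (reg 0) (forLoop y (reg 0) (increase s e)))

/-- `s := ∑ x < n, ∑ y < n, ∑ z < n, ∑ w < n, e`. -/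
def sumProg₄ (s x y z w : ℕ) (e : Expr) : Program :=
  .seq (setReg s (.const 0)) (forLoop x (reg 0) (forLoop y (reg 0) (forLoop z (reg 0)
    (forLoop w (reg 0) (increase s e)))))

theorem haltsIn_init_of_adds {s v T : ℕ} {F : Finset ℕ} {p : Program} {m : Memory} (hs : s ∈ F)
    (hv : v ≤ M) (h : Adds M s F p (m.set s 0 0) v T) :
    HaltsIn M (.seq (setReg s (.const 0)) p) m (1 + T) fun m' => m' s 0 = v ∧ AgreeOff F m m' := by
  refine HaltsIn.seq (HaltsIn.write (by simp [Expr.eval]) ?_)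
  simp only [Expr.eval]
  refine (h (by simpa [Memory.set_self] using hv)).mono le_rfl ?_
  rintro m' ⟨h1, h2⟩
  exact ⟨by simpa [Memory.set_self] using h1, ((AgreeOff.refl _ _).set hs _ _).trans h2⟩

theorem haltsIn_sumProg₁ {s x n : ℕ} {e : Expr} {m : Memory} {g : Fin n → ℕ}
    (hd : [0, s, x].Nodup) (hm : m 0 0 = n) (hn : n ≤ M)
    (he : ∀ (u : Fin n) (m' : Memory), AgreeOff {x, s} m m' → m' x 0 = u → e.eval m' = g u)
    (hg : ∑ u, g u ≤ M) :
    HaltsIn M (sumProg₁ s x e) m (3 * n + 3) fun m' =>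
      m' s 0 = ∑ u, g u ∧ AgreeOff {x, s} m m' := by
  simp only [List.nodup_cons, List.mem_cons, List.not_mem_nil, or_false, not_or] at hd
  refine (haltsIn_init_of_adds (by simp) hg (Adds.forLoop (T := 1) (by simp) ?_ ?_ ?_ hn
    fun u m' h hu => Adds.increase (he u m' ?_ hu))).mono (by omega) fun _ h => h
  · simp; tauto
  · simp; tauto
  · rw [Memory.set_of_ne _ (by tauto), hm]
  · exact ((AgreeOff.refl _ _).set (by simp) _ _).trans h

theorem haltsIn_sumProg₂ {s x y n : ℕ} {e : Expr} {m : Memory} {g : Fin n → Fin n → ℕ}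
    (hd : [0, s, x, y].Nodup) (hm : m 0 0 = n) (hn : n ≤ M)
    (he : ∀ (u v : Fin n) (m' : Memory), AgreeOff {x, y, s} m m' → m' x 0 = u → m' y 0 = v →
      e.eval m' = g u v)
    (hg : ∑ u, ∑ v, g u v ≤ M) :
    HaltsIn M (sumProg₂ s x y e) m (3 * n ^ 2 + 4 * n + 3) fun m' =>
      m' s 0 = ∑ u, ∑ v, g u v ∧ AgreeOff {x, y, s} m m' := by
  simp only [List.nodup_cons, List.mem_cons, List.not_mem_nil, or_false, not_or] at hd
  refine (haltsIn_init_of_adds (by simp) hg (Adds.forLoop (T := n * 3 + 2) (by simp) ?_ ?_ ?_ hn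
    fun u m₁ h₁ hu => Adds.forLoop (T := 1) (by simp) ?_ ?_ ?_ hn
    fun v m₂ h₂ hv => Adds.increase (he u v m₂ ?_ ?_ hv))).mono ?_ fun _ h => h
  any_goals (simp; tauto)
  · rw [Memory.set_of_ne _ (by tauto), hm]
  · rw [h₁ 0 (by simp; tauto), Memory.set_of_ne _ (by tauto), hm]
  · refine ((AgreeOff.refl _ _).set (by simp) _ _).trans (h₁.trans (h₂.mono ?_))
    intro a; simp; tauto
  · rw [h₂ x (by simp; tauto), hu]
  · apply le_of_eq; ring

theorem haltsIn_sumProg₄ {s x y z w n : ℕ} {e : Expr} {m : Memory}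
    {g : Fin n → Fin n → Fin n → Fin n → ℕ}
    (hd : [0, s, x, y, z, w].Nodup) (hm : m 0 0 = n) (hn : n ≤ M)
    (he : ∀ (u v u' v' : Fin n) (m' : Memory), AgreeOff {x, y, z, w, s} m m' → m' x 0 = u →
      m' y 0 = v → m' z 0 = u' → m' w 0 = v' → e.eval m' = g u v u' v')
    (hg : ∑ u, ∑ v, ∑ u', ∑ v', g u v u' v' ≤ M) :
    HaltsIn M (sumProg₄ s x y z w e) m (3 * n ^ 4 + 4 * n ^ 3 + 4 * n ^ 2 + 4 * n + 3) fun m' =>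
      m' s 0 = ∑ u, ∑ v, ∑ u', ∑ v', g u v u' v' ∧ AgreeOff {x, y, z, w, s} m m' := by
  simp only [List.nodup_cons, List.mem_cons, List.not_mem_nil, or_false, not_or] at hd
  refine (haltsIn_init_of_adds (by simp) hg
    (Adds.forLoop (T := n * (n * (n * 3 + 4) + 4) + 2) (by simp) ?_ ?_ ?_ hn
    fun u m₁ h₁ hu => Adds.forLoop (T := n * (n * 3 + 4) + 2) (by simp) ?_ ?_ ?_ hn
    fun v m₂ h₂ hv => Adds.forLoop (T := n * 3 + 2) (by simp) ?_ ?_ ?_ hn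
    fun u' m₃ h₃ hu' => Adds.forLoop (T := 1) (by simp) ?_ ?_ ?_ hn
    fun v' m₄ h₄ hv' => Adds.increase (he u v u' v' m₄ ?_ ?_ ?_ ?_ hv'))).mono ?_ fun _ h => h
  any_goals (simp; tauto)
  · rw [Memory.set_of_ne _ (by tauto), hm]
  · rw [h₁ 0 (by simp; tauto), Memory.set_of_ne _ (by tauto), hm]
  · rw [h₂ 0 (by simp; tauto), h₁ 0 (by simp; tauto), Memory.set_of_ne _ (by tauto), hm]
  · rw [h₃ 0 (by simp; tauto), h₂ 0 (by simp; tauto), h₁ 0 (by simp; tauto),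
      Memory.set_of_ne _ (by tauto), hm]
  · refine ((AgreeOff.refl _ _).set (by simp) _ _).trans (h₁.trans ((h₂.mono ?_).trans
      ((h₃.mono ?_).trans (h₄.mono ?_))))
    all_goals (intro a; simp; tauto)
  · rw [h₄ x (by simp; tauto), h₃ x (by simp; tauto), h₂ x (by simp; tauto), hu]
  · rw [h₄ y (by simp; tauto), h₃ y (by simp; tauto), hv]
  · rw [h₄ z (by simp; tauto), hu']
  · apply le_of_eq; ring

end RAM

/-! ### Cuts and the exchange argument -/

namespace BubbleCut

section Cuts

open Classical in
/-- The number of pairs in `S × T` that are adjacent in `G`. -/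
noncomputable def edgesBetween {V : Type*} (G : SimpleGraph V) (S T : Finset V) : ℕ :=
  ∑ u ∈ S, ∑ v ∈ T, if G.Adj u v then 1 else 0

/-- The cut size, as a sum over pairs of vertices. -/
noncomputable def cutValue {V : Type*} [Fintype V] [DecidableEq V] (G : SimpleGraph V)
    (S : Finset V) : ℕ :=
  edgesBetween G S Sᶜ

theorem edgesBetween_comm {V : Type*} (G : SimpleGraph V) (S T : Finset V) : edgesBetween G S T = edgesBetween G T S := by
  classical
  unfold edgesBetween
  rw [Finset.sum_comm]
  refine Finset.sum_congr rfl fun v _ => Finset.sum_congr rfl fun u _ => ?_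
  exact if_congr (G.adj_comm u v) rfl rfl

variable {V : Type*} [DecidableEq V] (G : SimpleGraph V)

theorem edgesBetween_union_left {S S' : Finset V} (h : Disjoint S S') (T : Finset V) :
    edgesBetween G (S ∪ S') T = edgesBetween G S T + edgesBetween G S' T :=
  Finset.sum_union h

theorem edgesBetween_union_right (S : Finset V) {T T' : Finset V} (h : Disjoint T T') :
    edgesBetween G S (T ∪ T') = edgesBetween G S T + edgesBetween G S T' := by
  rw [edgesBetween_comm, edgesBetween_union_left G h, edgesBetween_comm, edgesBetween_comm G T']

variable [Fintype V]

theorem cutValue_add_edgesBetween_self (S : Finset V) :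
    cutValue G S + edgesBetween G S S = edgesBetween G S Finset.univ := by
  rw [cutValue, ← edgesBetween_union_right G S disjoint_compl_left, Finset.union_comm,
    Finset.union_compl]

theorem cutValue_union {S T : Finset V} (h : Disjoint S T) :
    cutValue G (S ∪ T) + 2 * edgesBetween G S T = cutValue G S + cutValue G T := by
  have h1 := cutValue_add_edgesBetween_self G (S ∪ T)
  have h2 := cutValue_add_edgesBetween_self G S
  have h3 := cutValue_add_edgesBetween_self G T
  rw [edgesBetween_union_left G h, edgesBetween_union_left G h, edgesBetween_union_right G _ h,
    edgesBetween_union_right G _ h, edgesBetween_comm G T S] at h1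
  omega

theorem cutValue_eq_cutSize (S : Finset V) : cutValue G S = cutSize G S := by
  classical
  unfold cutValue edgesBetween cutSize
  rw [← Finset.sum_product', Finset.sum_boole, Nat.cast_id, ← Set.ncard_coe_finset]
  refine Set.ncard_congr (fun p _ => s(p.1, p.2)) ?_ ?_ ?_
  · rintro ⟨u, v⟩ h
    simp only [Finset.coe_filter, Finset.mem_product, Finset.mem_compl, Set.mem_ofPred_eq] at h
    exact ⟨h.2, u, h.1.1, v, h.1.2, rfl⟩
  · rintro ⟨u, v⟩ ⟨u', v'⟩ h h' he
    simp only [Finset.coe_filter, Finset.mem_product, Finset.mem_compl, Set.mem_ofPred_eq] at h h'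
    rcases Sym2.eq_iff.1 he with ⟨rfl, rfl⟩ | ⟨rfl, rfl⟩
    · rfl
    · exact absurd h.1.1 h'.1.2
  · rintro e ⟨he, u, hu, v, hv, rfl⟩
    exact ⟨(u, v), by simpa using ⟨⟨hu, hv⟩, he⟩, rfl⟩

end Cuts

section Twins

variable {V : Type*} {G : SimpleGraph V}

theorem areTwins_iff {u v : V} :
    AreTwins G u v ↔ G.Adj u v ∧ ∀ q, q ≠ u → q ≠ v → (G.Adj u q ↔ G.Adj v q) := by
  unfold AreTwins
  refine and_congr_right fun h => ?_
  rw [Set.ext_iff]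
  refine forall_congr' fun q => ?_
  simp only [Set.mem_sdiff, SimpleGraph.mem_neighborSet, Set.mem_singleton_iff]
  have := G.loopless.irrefl u
  have := G.loopless.irrefl v
  by_cases h1 : q = u
  · subst h1; simp_all
  · by_cases h2 : q = v
    · subst h2; simp_all
    · simp [h1, h2]

theorem AreTwins.symm {u v : V} (h : AreTwins G u v) : AreTwins G v u := ⟨h.1.symm, h.2.symm⟩

theorem AreTwins.ne {u v : V} (h : AreTwins G u v) : u ≠ v := h.1.ne

theorem AreTwins.adj {u v q : V} (h : AreTwins G u v) (hq : q ≠ v) (hu : G.Adj u q) :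
    G.Adj v q :=
  ((areTwins_iff.1 h).2 q hu.ne' hq).1 hu

theorem AreTwins.trans {u v w : V} (h : AreTwins G u v) (h' : AreTwins G v w) (hne : u ≠ w) :
    AreTwins G u w := by
  have huw : G.Adj u w := h.symm.adj hne.symm h'.1
  refine areTwins_iff.2 ⟨huw, fun q hu hw => ?_⟩
  by_cases hv : q = v
  · subst hv
    exact iff_of_true h.1 h'.1.symm
  · exact ((areTwins_iff.1 h).2 q hu hv).trans ((areTwins_iff.1 h').2 q hv hw)

/-- The graph of pairs of twins of `G`. Its connected components are the bubbles. -/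
def twinGraph (G : SimpleGraph V) : SimpleGraph V where
  Adj := AreTwins G
  symm := ⟨fun _ _ h => h.symm⟩
  loopless := ⟨fun _ h => h.ne rfl⟩

theorem AreTwins.twinGraph {u v : V} (h : AreTwins G u v) : AreTwins (twinGraph G) u v :=
  areTwins_iff.2 ⟨h, fun _ hu hv => ⟨fun h' => h.symm.trans h' hv.symm,
    fun h' => h.trans h' hu.symm⟩⟩

end Twins

section Exchange

variable {V : Type*} [DecidableEq V] (H : SimpleGraph V)

open Classical in
theorem edgesBetween_erase {S : Finset V} {w : V} (hw : w ∈ S) (p : V) :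
    edgesBetween H {p} (S.erase w) + (if H.Adj p w then 1 else 0) = edgesBetween H {p} S := by
  simp only [edgesBetween, Finset.sum_singleton]
  exact Finset.sum_erase_add S _ hw

theorem AreTwins.edgesBetween_singleton {H : SimpleGraph V} {u u' : V} (h : AreTwins H u u')
    {S : Finset V} (hu : u ∈ S) (hu' : u' ∉ S) :
    edgesBetween H {u'} S = edgesBetween H {u} S + 1 := by
  classical
  have h1 := edgesBetween_erase H hu u
  have h2 := edgesBetween_erase H hu u'
  rw [if_neg (H.loopless.irrefl u)] at h1
  rw [if_pos h.1.symm] at h2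
  have : edgesBetween H {u} (S.erase u) = edgesBetween H {u'} (S.erase u) := by
    simp only [edgesBetween, Finset.sum_singleton]
    refine Finset.sum_congr rfl fun q hq => ?_
    have hq' := Finset.mem_erase.1 hq
    have : q ≠ u' := fun e => hu' (e ▸ hq'.2)
    simp only [(areTwins_iff.1 h).2 q hq'.1 this]
  omega

variable [Fintype V]

open Classical in
/-- The effect of an exchange on the cut size. -/
theorem cutValue_exchange {S : Finset V} {w p : V} (hw : w ∈ S) (hp : p ∉ S) :
    cutValue H (insert p (S.erase w)) + cutValue H {w} + 2 * edgesBetween H {p} S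
      = cutValue H S + 2 * edgesBetween H {w} S + cutValue H {p}
        + 2 * (if H.Adj p w then 1 else 0) := by
  have h1 := cutValue_union H (S := {w}) (T := S.erase w) (by simp)
  have h2 := cutValue_union H (S := {p}) (T := S.erase w) (by simp [hp])
  rw [← Finset.insert_eq, Finset.insert_erase hw] at h1
  rw [← Finset.insert_eq] at h2
  have h3 := edgesBetween_erase H hw w
  have h4 := edgesBetween_erase H hw p
  rw [if_neg (H.loopless.irrefl w)] at h3
  omega

theorem AreTwins.cutValue_singleton {H : SimpleGraph V} {u u' : V} (h : AreTwins H u u') :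
    cutValue H {u} = cutValue H {u'} := by
  classical
  have key : ∀ x : V, cutValue H {x} = edgesBetween H {x} Finset.univ := by
    intro x
    rw [← cutValue_add_edgesBetween_self]
    simp [edgesBetween]
  rw [key, key]
  simp only [edgesBetween, Finset.sum_singleton]
  refine Finset.sum_equiv (Equiv.swap u u') (by simp) fun q _ => ?_
  by_cases h1 : q = u
  · subst h1; simp
  by_cases h2 : q = u'
  · subst h2; simp [h.1, h.1.symm]
  rw [Equiv.swap_apply_of_ne_of_ne h1 h2]
  simp only [(areTwins_iff.1 h).2 q h1 h2]

/-- Exchanging two twins does not change the cut size. -/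
theorem AreTwins.cutValue_exchange {H : SimpleGraph V} {u u' : V} (h : AreTwins H u u')
    {S : Finset V} (hu : u ∈ S) (hu' : u' ∉ S) :
    cutValue H (insert u' (S.erase u)) = cutValue H S := by
  classical
  have h1 := BubbleCut.cutValue_exchange H hu hu'
  have h2 := h.edgesBetween_singleton hu hu'
  have h3 := h.cutValue_singleton
  rw [if_pos h.1.symm] at h1
  omega

open Classical in
/-- Let `S` split both the twins `u`, `u'` and the twins `w`, `w'`. Shifting `S` by one vertex from
the class of `w` to the class of `u`, or the other way, changes the cut size by amounts whose sum
depends only on the adjacencies between the classes. -/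
theorem cutValue_shift_add_cutValue_shift {H : SimpleGraph V} {u u' w w' : V} {S : Finset V}
    (h : AreTwins H u u') (h' : AreTwins H w w')
    (hu : u ∈ S) (hu' : u' ∉ S) (hw : w ∈ S) (hw' : w' ∉ S) :
    cutValue H (insert u' (S.erase w)) + cutValue H (insert w' (S.erase u)) + 4
      = 2 * cutValue H S + 2 * (if H.Adj u' w then 1 else 0) + 2 * (if H.Adj w' u then 1 else 0) := by
  have h1 := cutValue_exchange H hw hu'
  have h2 := cutValue_exchange H hu hw'
  have h3 := h.edgesBetween_singleton hu hu'
  have h4 := h.cutValue_singleton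
  have h5 := h'.edgesBetween_singleton hw hw'
  have h6 := h'.cutValue_singleton
  omega

end Exchange

section Canonical

variable {n : ℕ}

/-- A set of vertices is canonical up to `k` if it contains an initial segment of every bubble, and
if no two different, adjacent bubbles are split, where a bubble counts as split if it has a member
in `X` and a member below `k` outside `X`. -/
structure IsCanonical (G : SimpleGraph (Fin n)) (k : ℕ) (X : Finset (Fin n)) : Prop where
  mem_of_lt : ∀ ⦃u u'⦄, AreTwins G u u' → u < u' → u' ∈ X → u ∈ X
  areTwins_of_split : ∀ ⦃u u' w w'⦄, AreTwins G u u' → AreTwins G w w' → u ∈ X → w ∈ X →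
    u' ∉ X → w' ∉ X → u'.val < k → w'.val < k → G.Adj u w → AreTwins G u w

/-- Some maximum cut is canonical: among the maximum cuts, one that is lexicographically minimal
with respect to the number of split pairs of twins and the sum of the vertex numbers. -/
theorem exists_isCanonical_forall_cutValue_le (G : SimpleGraph (Fin n)) :
    ∃ Y, IsCanonical G n Y ∧ ∀ S, cutValue G S ≤ cutValue G Y := by
  classical
  obtain ⟨S₀, -, hS₀⟩ := Finset.exists_max_image (Finset.univ : Finset (Finset (Fin n)))
    (cutValue G) Finset.univ_nonempty
  obtain ⟨Y, hY, hmin⟩ := Finset.exists_min_image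
    (Finset.univ.filter fun S => cutValue G S = cutValue G S₀)
    (fun S => toLex (cutValue (twinGraph G) S, ∑ u ∈ S, u.val)) ⟨S₀, by simp⟩
  simp only [Finset.mem_filter, Finset.mem_univ, true_and] at hY hmin hS₀
  have hmax : ∀ S, cutValue G S ≤ cutValue G Y := fun S => hY ▸ hS₀ S trivial
  refine ⟨Y, ⟨?_, ?_⟩, hmax⟩
  · intro u u' ht hlt hu'
    by_contra hu
    have h1 := hmin _ ((ht.symm.cutValue_exchange hu' hu).trans hY)
    rw [ht.symm.twinGraph.cutValue_exchange hu' hu, Prod.Lex.toLex_le_toLex] at h1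
    have h2 := h1.resolve_left (lt_irrefl _)
    have h3 := h2.2
    rw [Finset.sum_insert (by simp [hu])] at h3
    have h4 := Finset.add_sum_erase Y (fun u => u.val) hu'
    have h5 : u.val < u'.val := hlt
    simp only at h3 h4
    omega
  · intro u u' w w' htu htw hu hw hu' hw' _ _ huw
    by_contra hn
    have hwu' : w ≠ u' := fun e => hu' (e ▸ hw)
    have huw' : u ≠ w' := fun e => hw' (e ▸ hu)
    have h1 := cutValue_shift_add_cutValue_shift htu htw hu hu' hw hw'
    have h2 := cutValue_shift_add_cutValue_shift htu.twinGraph htw.twinGraph hu hu' hw hw'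
    rw [if_pos (htu.adj hwu' huw), if_pos (htw.adj huw' huw.symm)] at h1
    rw [if_neg (show ¬ (twinGraph G).Adj u' w from fun h => hn (htu.trans h huw.ne)),
      if_neg (show ¬ (twinGraph G).Adj w' u from fun h => hn (htw.trans h huw.ne').symm)] at h2
    have h3 := hmax (insert u' (Y.erase w))
    have h4 := hmax (insert w' (Y.erase u))
    have h5 := hmin (insert u' (Y.erase w)) (by omega)
    have h6 := hmin (insert w' (Y.erase u)) (by omega)
    rw [Prod.Lex.toLex_le_toLex] at h5 h6
    simp only at h5 h6
    omega

theorem IsCanonical.mono {G : SimpleGraph (Fin n)} {k k' : ℕ} {X : Finset (Fin n)}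
    (h : IsCanonical G k' X) (hk : k ≤ k') : IsCanonical G k X :=
  ⟨h.1, fun _ _ _ _ h1 h2 h3 h4 h5 h6 h7 h8 =>
    h.2 h1 h2 h3 h4 h5 h6 (h7.trans_le hk) (h8.trans_le hk)⟩

end Canonical

/-! ### Counting canonical sets -/

section Counting

variable {n : ℕ} {G : SimpleGraph (Fin n)}

open Classical in
/-- The bubble that contains `u`. -/
noncomputable def bubbleOf (G : SimpleGraph (Fin n)) (u : Fin n) : Finset (Fin n) :=
  {v | v = u ∨ AreTwins G u v}

theorem mem_bubbleOf {u v : Fin n} : v ∈ bubbleOf G u ↔ v = u ∨ AreTwins G u v := by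
  simp [bubbleOf]

theorem isBubble_bubbleOf (u : Fin n) : IsBubble G (bubbleOf G u) := by
  refine ⟨fun x hx y hy hne => ?_, fun B hB hle x hx => ?_⟩
  · rw [Finset.mem_coe, mem_bubbleOf] at hx hy
    rcases hx with rfl | hx
    · exact hy.resolve_left hne.symm
    · rcases hy with rfl | hy
      · exact hx.symm
      · exact hx.symm.trans hy hne
  · rw [mem_bubbleOf]
    by_cases h : x = u
    · exact Or.inl h
    · exact Or.inr (hB (hle (mem_bubbleOf.2 (Or.inl rfl))) hx (Ne.symm h))

theorem IsBubble.eq_bubbleOf {B : Finset (Fin n)} (hB : IsBubble G B) {u : Fin n} (hu : u ∈ B) :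
    B = bubbleOf G u := by
  refine hB.eq_of_le (isBubble_bubbleOf u).prop fun x hx => ?_
  rw [mem_bubbleOf]
  by_cases h : x = u
  · exact Or.inl h
  · exact Or.inr (hB.prop hu hx (Ne.symm h))

variable {P : Finpartition (Finset.univ : Finset (Fin n))}

theorem IsBubblePartition.bubbleOf_subset (hP : IsBubblePartition G P) {A : Finset (Fin n)}
    (hA : A ∈ P.parts) {u : Fin n} (hu : u ∈ A) : bubbleOf G u ⊆ A := by
  obtain ⟨F, hF, rfl⟩ := hP.1 A hA
  obtain ⟨B, hB, huB⟩ := Finset.mem_biUnion.1 hu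
  rw [← (hF B hB).eq_bubbleOf huB]
  exact Finset.subset_biUnion_of_mem id hB

open Classical in
/-- The first missing vertices of `X`: those vertices below `k` outside `X` whose bubble meets `X`
and such that `X` contains all earlier vertices of this bubble. -/
noncomputable def firstMissing (G : SimpleGraph (Fin n)) (k : ℕ) (X : Finset (Fin n)) :
    Finset (Fin n) :=
  {v | v.val < k ∧ v ∉ X ∧ (∃ u ∈ X, AreTwins G u v) ∧ ∀ u, u < v → AreTwins G u v → u ∈ X}

theorem mem_firstMissing {k : ℕ} {X : Finset (Fin n)} {v : Fin n} :
    v ∈ firstMissing G k X ↔ v.val < k ∧ v ∉ X ∧ (∃ u ∈ X, AreTwins G u v) ∧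
      ∀ u, u < v → AreTwins G u v → u ∈ X := by
  simp [firstMissing]

/-- No two different bubbles split by a canonical set are adjacent, hence its first missing
vertices are independent. -/
theorem IsCanonical.not_adj_firstMissing {k : ℕ} {X : Finset (Fin n)} (hX : IsCanonical G k X)
    {v w : Fin n} (hv : v ∈ firstMissing G k X) (hw : w ∈ firstMissing G k X) : ¬ G.Adj v w := by
  rw [mem_firstMissing] at hv hw
  obtain ⟨hvk, hvX, ⟨u, huX, huv⟩, hvmin⟩ := hv
  obtain ⟨hwk, hwX, ⟨x, hxX, hxw⟩, hwmin⟩ := hw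
  intro hadj
  have htw : AreTwins G v w := by
    by_cases hux : u = x
    · subst hux
      exact huv.symm.trans hxw hadj.ne
    · have h1 : G.Adj u w := huv.symm.adj (fun e => hwX (e ▸ huX)) hadj
      have h2 : G.Adj x u := hxw.symm.adj hux h1.symm
      have h3 := hX.areTwins_of_split huv hxw huX hxX hvX hwX hvk hwk h2.symm
      exact huv.symm.trans (h3.trans hxw h1.ne) hadj.ne
  rcases lt_or_gt_of_ne hadj.ne with h | h
  · exact hvX (hwmin v h htw)
  · exact hwX (hvmin w h htw.symm)

/-- A canonical set below `k` is determined by the bubbles that it meets and by its first missing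
vertices. -/
theorem IsCanonical.subset_of_image_bubbleOf_eq {k : ℕ} {X X' : Finset (Fin n)}
    (hX : IsCanonical G k X) (hk : ∀ u ∈ X, u.val < k)
    (h : X.image (bubbleOf G) = X'.image (bubbleOf G))
    (h' : firstMissing G k X = firstMissing G k X') : X ⊆ X' := by
  classical
  intro x hx
  by_contra hx'
  have hxm : bubbleOf G x ∈ X'.image (bubbleOf G) := h ▸ Finset.mem_image_of_mem _ hx
  obtain ⟨y, hy, hyx⟩ := Finset.mem_image.1 hxm
  have hyx' : x ∈ bubbleOf G y := hyx ▸ mem_bubbleOf.2 (Or.inl rfl)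
  have htw : AreTwins G y x := (mem_bubbleOf.1 hyx').resolve_left fun e => hx' (e ▸ hy)
  -- the first vertex of the bubble of `x` that `X'` misses
  obtain ⟨v, hv, hvmin⟩ := Finset.exists_min_image
    (Finset.univ.filter fun v => v ∈ bubbleOf G x ∧ v ∉ X') id
    ⟨x, by simp [mem_bubbleOf, hx']⟩
  simp only [Finset.mem_filter, Finset.mem_univ, true_and, id] at hv hvmin
  have hvx : v ≤ x := hvmin x ⟨mem_bubbleOf.2 (Or.inl rfl), hx'⟩
  have hvR : v ∈ firstMissing G k X' := by
    rw [mem_firstMissing]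
    refine ⟨lt_of_le_of_lt hvx (hk x hx), hv.2, ⟨y, hy, ?_⟩, fun u hu hut => ?_⟩
    · rcases mem_bubbleOf.1 hv.1 with rfl | h1
      · exact htw
      · exact htw.trans h1 fun e => hv.2 (e ▸ hy)
    · by_contra huX
      refine absurd (hvmin u ⟨?_, huX⟩) (not_le.2 hu)
      rw [mem_bubbleOf]
      by_cases hux : u = x
      · exact Or.inl hux
      · rcases mem_bubbleOf.1 hv.1 with rfl | h1
        · exact Or.inr hut.symm
        · exact Or.inr (h1.trans hut.symm (Ne.symm hux))
  rw [← h', mem_firstMissing] at hvR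
  rcases mem_bubbleOf.1 hv.1 with rfl | h1
  · exact hvR.2.1 hx
  · exact hvR.2.1 (hX.mem_of_lt h1.symm (lt_of_le_of_ne hvx h1.ne.symm) hx)

theorem card_filter_card_le (n a : ℕ) :
    (Finset.univ.filter fun R : Finset (Fin n) => R.card ≤ a).card ≤ n ^ a + 1 := by
  classical
  have hsub : (Finset.univ.filter fun R : Finset (Fin n) => R.card ≤ a)
      ⊆ insert ∅ (Finset.univ.image fun f : Fin a → Fin n => Finset.univ.image f) := by
    intro R hR
    simp only [Finset.mem_filter, Finset.mem_univ, true_and] at hR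
    rcases R.eq_empty_or_nonempty with rfl | ⟨x, hx⟩
    · simp
    refine Finset.mem_insert_of_mem (Finset.mem_image.2
      ⟨fun i => if h : i.val < R.card then R.equivFin.symm ⟨i, h⟩ else x, Finset.mem_univ _, ?_⟩)
    ext y
    simp only [Finset.mem_image, Finset.mem_univ, true_and]
    constructor
    · rintro ⟨i, rfl⟩
      split_ifs
      exacts [Subtype.prop _, hx]
    · intro hy
      refine ⟨⟨R.equivFin ⟨y, hy⟩, (R.equivFin ⟨y, hy⟩).2.trans_le hR⟩, ?_⟩
      simp
  refine (Finset.card_le_card hsub).trans ((Finset.card_insert_le _ _).trans ?_)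
  have := Finset.card_image_le (s := (Finset.univ : Finset (Fin a → Fin n)))
    (f := fun f : Fin a → Fin n => Finset.univ.image f)
  simp only [Finset.card_univ, Fintype.card_fun, Fintype.card_fin] at this
  omega

/-- A bound for the number of canonical subsets of a part. -/
noncomputable def stateBound (G : SimpleGraph (Fin n))
    (P : Finpartition (Finset.univ : Finset (Fin n))) : ℕ :=
  2 ^ width G P * (n ^ independenceNumber G P + 1)

theorem card_le_stateBound_of_mem_parts (hP : IsBubblePartition G P) {A : Finset (Fin n)}
    (hA : A ∈ P.parts) {k : ℕ} {𝒳 : Finset (Finset (Fin n))}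
    (h𝒳 : ∀ X ∈ 𝒳, IsCanonical G k X ∧ X ⊆ A ∧ ∀ u ∈ X, u.val < k) :
    𝒳.card ≤ stateBound G P := by
  classical
  have hfin : {B : Finset (Fin n) | IsBubble G B ∧ B ⊆ A}.Finite := Set.toFinite _
  have hw : hfin.toFinset.card ≤ width G P := by
    rw [← Set.ncard_eq_toFinset_card]
    exact Finset.le_sup (f := fun A => {B : Finset (Fin n) | IsBubble G B ∧ B ⊆ A}.ncard) hA
  have hα : (G.induce (A : Set (Fin n))).indepNum ≤ independenceNumber G P :=
    Finset.le_sup (f := fun A : Finset (Fin n) => (G.induce (A : Set (Fin n))).indepNum) hA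
  have key : 𝒳.card ≤ (hfin.toFinset.powerset ×ˢ
      (Finset.univ.filter fun R : Finset (Fin n) => R.card ≤ independenceNumber G P)).card := by
    refine Finset.card_le_card_of_injOn
      (fun X => (X.image (bubbleOf G), firstMissing G k X)) ?_ ?_
    · intro X hX
      obtain ⟨hcan, hXA, hXk⟩ := h𝒳 X hX
      have hRA : firstMissing G k X ⊆ A := by
        intro v hv
        obtain ⟨-, -, ⟨u, hu, huv⟩, -⟩ := mem_firstMissing.1 hv
        exact hP.bubbleOf_subset hA (hXA hu) (mem_bubbleOf.2 (Or.inr huv))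
      simp only [Finset.mem_coe, Finset.mem_product, Finset.mem_powerset, Finset.mem_filter,
        Finset.mem_univ, true_and]
      constructor
      · intro B hB
        obtain ⟨u, hu, rfl⟩ := Finset.mem_image.1 hB
        simpa using ⟨isBubble_bubbleOf u, hP.bubbleOf_subset hA (hXA hu)⟩
      · refine le_trans (le_of_eq ?_) ((SimpleGraph.IsIndepSet.card_le_indepNum
          (G := G.induce (A : Set (Fin n)))
          (t := (firstMissing G k X).subtype (· ∈ (A : Set (Fin n)))) ?_).trans hα)
        · rw [Finset.card_subtype, Finset.filter_true_of_mem]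
          exact fun v hv => hRA hv
        · intro v hv w hw _
          simp only [Finset.mem_coe, Finset.mem_subtype] at hv hw
          exact hcan.not_adj_firstMissing hv hw
    · intro X hX X' hX' he
      obtain ⟨hcan, -, hXk⟩ := h𝒳 X hX
      obtain ⟨hcan', -, hXk'⟩ := h𝒳 X' hX'
      simp only [Prod.mk.injEq] at he
      exact (hcan.subset_of_image_bubbleOf_eq hXk he.1 he.2).antisymm
        (hcan'.subset_of_image_bubbleOf_eq hXk' he.1.symm he.2.symm)
  refine key.trans ?_
  rw [Finset.card_product, Finset.card_powerset]
  exact Nat.mul_le_mul (Nat.pow_le_pow_right (by norm_num) hw) (card_filter_card_le _ _)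

theorem IsLabelling.filter_mem_parts {c : Fin n → Fin n} (hc : IsLabelling P c) (u : Fin n) :
    (Finset.univ.filter fun v => c v = c u) ∈ P.parts := by
  obtain ⟨A, hA, hu, -⟩ := (hc u u).1 rfl
  convert hA
  ext v
  simp only [Finset.mem_filter, Finset.mem_univ, true_and]
  rw [hc v u]
  constructor
  · rintro ⟨B, hB, hv, hu'⟩
    rwa [P.eq_of_mem_parts hA hB hu hu']
  · exact fun hv => ⟨A, hA, hv, hu⟩

/-- The number of canonical sets of vertices with a given label is at most `stateBound G P`. -/
theorem card_le_stateBound (hP : IsBubblePartition G P) {c : Fin n → Fin n}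
    (hc : IsLabelling P c) (a : Fin n) {k : ℕ} {𝒳 : Finset (Finset (Fin n))}
    (h𝒳 : ∀ X ∈ 𝒳, IsCanonical G k X ∧ ∀ u ∈ X, c u = a ∧ u.val < k) :
    𝒳.card ≤ stateBound G P := by
  by_cases ha : ∃ u, c u = a
  · obtain ⟨u, rfl⟩ := ha
    exact card_le_stateBound_of_mem_parts hP (hc.filter_mem_parts u) fun X hX =>
      ⟨(h𝒳 X hX).1, fun v hv => by simpa using ((h𝒳 X hX).2 v hv).1,
        fun v hv => ((h𝒳 X hX).2 v hv).2⟩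
  · have hsub : 𝒳 ⊆ {∅} := by
      intro X hX
      rw [Finset.mem_singleton, Finset.eq_empty_iff_forall_notMem]
      exact fun v hv => ha ⟨v, ((h𝒳 X hX).2 v hv).1⟩
    refine (Finset.card_le_card hsub).trans ?_
    rw [Finset.card_singleton]
    exact Nat.succ_le_of_lt (Nat.mul_pos (by positivity) (Nat.succ_pos _))

end Counting

/-! ### Merging the parts along the tree -/

section Merging

variable {n : ℕ} {G : SimpleGraph (Fin n)} {P : Finpartition (Finset.univ : Finset (Fin n))}
  {c : Fin n → Fin n}

/-- A finite forest has a vertex of degree at most one: take an end of a longest path. -/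
theorem exists_forall_adj_eq_of_isAcyclic {V : Type*} [Finite V] [Nonempty V] {F : SimpleGraph V}
    (hF : F.IsAcyclic) : ∃ u, ∀ v w, F.Adj u v → F.Adj u w → v = w := by
  obtain ⟨u, v, p, hp, hmax⟩ := SimpleGraph.Walk.exists_isPath_forall_isPath_length_le_length F
  -- all neighbours of an end of a longest path lie on the path
  have key : ∀ w, F.Adj u w → w = p.snd := by
    intro w hw
    refine hF.eq_snd_of_adj_start hp hw ?_
    by_contra hmem
    have := hmax _ _ (p.cons hw.symm) (hp.cons hmem)
    simp at this
  exact ⟨u, fun w w' h h' => (key w h).trans (key w' h').symm⟩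

/-- Among the vertices with a label in `D`, those with label `a` have no neighbours with labels
other than `a` and `b`. -/
def IsMergeable (G : SimpleGraph (Fin n)) (c : Fin n → Fin n) (D : Finset (Fin n))
    (a b : Fin n) : Prop :=
  a ∈ D ∧ b ∈ D ∧ a ≠ b ∧ ∀ u v, c u = a → c v ∈ D → c v ≠ a → c v ≠ b → ¬ G.Adj u v

/-- Any two or more parts induce a forest in the contraction, so that one of them is adjacent to at
most one other. -/
theorem exists_isMergeable (hP : IsBubblePartition G P) (hc : IsLabelling P c)
    {D : Finset (Fin n)} (hD : 2 ≤ D.card) : ∃ a b, IsMergeable G c D a b := by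
  have hD' : 1 < D.card := hD
  by_cases hused : ∃ a ∈ D, ∀ u, c u ≠ a
  · obtain ⟨a, ha, hau⟩ := hused
    obtain ⟨b, hb, hba⟩ := Finset.exists_mem_ne hD' a
    exact ⟨a, b, ha, hb, hba.symm, fun u v hu => absurd hu (hau u)⟩
  push Not at hused
  have hpart : ∀ a : D, (Finset.univ.filter fun v => c v = a) ∈ P.parts := by
    rintro ⟨a, ha⟩
    obtain ⟨u, rfl⟩ := hused a ha
    exact hc.filter_mem_parts u
  let F : SimpleGraph D :=
    { Adj := fun a b => a ≠ b ∧ ∃ u v, c u = a ∧ c v = b ∧ G.Adj u v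
      symm := ⟨fun _ _ ⟨h, u, v, hu, hv, ha⟩ => ⟨h.symm, v, u, hv, hu, ha.symm⟩⟩
      loopless := ⟨fun _ h => h.1 rfl⟩ }
  let f : D → {A : Finset (Fin n) // A ∈ P.parts} := fun a => ⟨_, hpart a⟩
  have hf : Function.Injective f := by
    rintro ⟨a, ha⟩ ⟨b, hb⟩ hab
    obtain ⟨u, hu⟩ := hused a ha
    have hab' : (Finset.univ.filter fun v => c v = a) = Finset.univ.filter fun v => c v = b :=
      congrArg Subtype.val hab
    have : u ∈ Finset.univ.filter fun v => c v = b := hab' ▸ by simpa using hu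
    simp only [Finset.mem_filter, Finset.mem_univ, true_and] at this
    exact Subtype.ext (hu.symm.trans this)
  have hacyc : F.IsAcyclic := by
    refine hP.2.isAcyclic.comap (f := ⟨f, ?_⟩) hf
    rintro a b ⟨hne, u, v, hu, hv, hadj⟩
    exact ⟨hf.ne hne, u, by simpa [f] using hu, v, by simpa [f] using hv, hadj⟩
  have : Nonempty D := (Finset.card_pos.1 (by omega)).to_subtype
  obtain ⟨⟨a, ha⟩, hleaf⟩ := exists_forall_adj_eq_of_isAcyclic hacyc
  by_cases hnb : ∃ b, F.Adj ⟨a, ha⟩ b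
  · obtain ⟨⟨b, hb⟩, hab⟩ := hnb
    refine ⟨a, b, ha, hb, fun e => hab.1 (Subtype.ext e), fun u v hu hv hva hvb hadj => hvb ?_⟩
    have h1 : F.Adj ⟨a, ha⟩ ⟨c v, hv⟩ :=
      ⟨fun e => hva (congrArg Subtype.val e).symm, u, v, hu, rfl, hadj⟩
    exact congrArg Subtype.val (hleaf _ _ h1 hab)
  · obtain ⟨b, hb, hba⟩ := Finset.exists_mem_ne hD' a
    refine ⟨a, b, ha, hb, hba.symm, fun u v hu hv hva _ hadj => hnb ⟨⟨c v, hv⟩, ?_⟩⟩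
    exact ⟨fun e => hva (congrArg Subtype.val e).symm, u, v, hu, rfl, hadj⟩

theorem AreTwins.label_eq (hP : IsBubblePartition G P) (hc : IsLabelling P c) {u v : Fin n}
    (h : AreTwins G u v) : c u = c v := by
  have := hP.bubbleOf_subset (hc.filter_mem_parts u) (u := u) (by simp)
    (mem_bubbleOf.2 (Or.inr h))
  exact (Finset.mem_filter.1 this).2.symm

/-- The table `L` lists, for every label, the canonical sets of vertices below `k` with this
label. -/
def IsStateTable (G : SimpleGraph (Fin n)) (c : Fin n → Fin n) (k : ℕ)
    (L : Fin n → List (Finset (Fin n))) : Prop :=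
  ∀ a, (L a).Nodup ∧ ∀ X, X ∈ L a ↔ IsCanonical G k X ∧ ∀ u ∈ X, c u = a ∧ u.val < k

theorem isStateTable_zero : IsStateTable G c 0 fun _ => [∅] := by
  refine fun a => ⟨by simp, fun X => ?_⟩
  simp only [List.mem_singleton]
  constructor
  · rintro rfl
    exact ⟨⟨by simp, by simp⟩, by simp⟩
  · rintro ⟨-, h⟩
    rw [Finset.eq_empty_iff_forall_notMem]
    exact fun u hu => by simpa using (h u hu).2

theorem IsStateTable.length_le {k : ℕ} {L : Fin n → List (Finset (Fin n))}
    (hL : IsStateTable G c k L) (hP : IsBubblePartition G P) (hc : IsLabelling P c) (a : Fin n) :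
    (L a).length ≤ stateBound G P := by
  rw [← List.toFinset_card_of_nodup (hL a).1]
  exact card_le_stateBound hP hc a fun X hX => ((hL a).2 X).1 (List.mem_toFinset.1 hX)

open Classical in
/-- The canonical sets among the members `X` of `l` and their extensions `insert v X`. -/
noncomputable def extendStates (G : SimpleGraph (Fin n)) (v : Fin n)
    (l : List (Finset (Fin n))) : List (Finset (Fin n)) :=
  l.flatMap fun X => [X, insert v X].filter fun Y => IsCanonical G (v.val + 1) Y

theorem IsStateTable.update (hP : IsBubblePartition G P) (hc : IsLabelling P c)
    {v : Fin n} {L : Fin n → List (Finset (Fin n))} (hL : IsStateTable G c v.val L) :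
    IsStateTable G c (v.val + 1) (Function.update L (c v) (extendStates G v (L (c v)))) := by
  classical
  intro a
  by_cases ha : a = c v
  · subst ha
    rw [Function.update_self]
    have hv : ∀ X ∈ L (c v), v ∉ X := fun X hX hvX =>
      lt_irrefl _ ((((hL (c v)).2 X).1 hX).2 v hvX).2
    constructor
    · rw [extendStates, List.nodup_flatMap]
      refine ⟨fun X hX => List.Nodup.filter _ ?_, (hL (c v)).1.imp_of_mem ?_⟩
      · have : X ≠ insert v X := fun e => hv X hX (e ▸ Finset.mem_insert_self v X)
        simpa using this
      · intro X X' hX hX' hne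
        -- the members of both lists agree with `X` and `X'` below `v`
        have key : ∀ Z ∈ L (c v), ∀ Y ∈ [Z, insert v Z].filter
            fun Y => IsCanonical G (v.val + 1) Y, Y.erase v = Z := by
          intro Z hZ Y hY
          have := (List.mem_filter.1 hY).1
          simp only [List.mem_cons, List.not_mem_nil, or_false] at this
          rcases this with rfl | rfl
          · exact Finset.erase_eq_of_notMem (hv _ hZ)
          · exact Finset.erase_insert (hv _ hZ)
        exact fun Y hY hY' => hne ((key X hX Y hY).symm.trans (key X' hX' Y hY'))
    · intro X
      simp only [extendStates, List.mem_flatMap, List.mem_filter, List.mem_cons, List.not_mem_nil,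
        or_false, decide_eq_true_eq]
      constructor
      · rintro ⟨Z, hZ, hXZ, hX⟩
        have hZ' := (((hL (c v)).2 Z).1 hZ).2
        refine ⟨hX, fun u hu => ?_⟩
        rcases hXZ with rfl | rfl
        · exact ⟨(hZ' u hu).1, (hZ' u hu).2.trans (Nat.lt_succ_self _)⟩
        · rcases Finset.mem_insert.1 hu with rfl | hu
          · exact ⟨rfl, Nat.lt_succ_self _⟩
          · exact ⟨(hZ' u hu).1, (hZ' u hu).2.trans (Nat.lt_succ_self _)⟩
      · rintro ⟨hX, hXv⟩
        refine ⟨X.erase v, ((hL (c v)).2 _).2 ⟨⟨?_, ?_⟩, ?_⟩, ?_, hX⟩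
        · intro u u' ht hlt hu'
          have huX := Finset.mem_of_mem_erase hu'
          refine Finset.mem_erase.2 ⟨fun e => ?_, hX.mem_of_lt ht hlt huX⟩
          subst e
          have := (hXv u' huX).2
          have : u.val < u'.val := hlt
          omega
        · intro u u' w w' htu htw hu hw hu' hw' hku hkw hadj
          have h : ∀ x : Fin n, x ∉ X.erase v → x.val < v.val → x ∉ X := fun x hx hxv hxX =>
            hx (Finset.mem_erase.2 ⟨fun e => by subst e; exact lt_irrefl _ hxv, hxX⟩)
          exact hX.areTwins_of_split htu htw (Finset.mem_of_mem_erase hu)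
            (Finset.mem_of_mem_erase hw) (h u' hu' hku) (h w' hw' hkw) (by omega) (by omega) hadj
        · intro u hu
          obtain ⟨hne, hu⟩ := Finset.mem_erase.1 hu
          have h1 := hXv u hu
          refine ⟨h1.1, ?_⟩
          have : u.val ≠ v.val := fun e => hne (Fin.ext e)
          omega
        · by_cases hvX : v ∈ X
          · exact Or.inr (Finset.insert_erase hvX).symm
          · exact Or.inl (Finset.erase_eq_of_notMem hvX).symm
  · rw [Function.update_of_ne ha]
    refine ⟨(hL a).1, fun X => ((hL a).2 X).trans ⟨?_, ?_⟩⟩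
    · rintro ⟨hX, hXv⟩
      -- the vertex `v` has a different label, hence no twins in `X`
      have hlt : ∀ u ∈ X, ∀ u', AreTwins G u u' → u'.val < v.val + 1 → u'.val < v.val := by
        intro u hu u' ht hk
        have : u'.val ≠ v.val := fun e => ha (by
          rw [← Fin.ext e, ← ht.label_eq hP hc, (hXv u hu).1])
        omega
      exact ⟨⟨hX.1, fun u u' w w' htu htw hu hw hu' hw' hku hkw hadj =>
        hX.2 htu htw hu hw hu' hw' (hlt u hu u' htu hku) (hlt w hw w' htw hkw) hadj⟩,
        fun u hu => ⟨(hXv u hu).1, by have := (hXv u hu).2; omega⟩⟩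
    · rintro ⟨hX, hXv⟩
      refine ⟨hX.mono (Nat.le_succ _), fun u hu => ⟨(hXv u hu).1, ?_⟩⟩
      have : u.val ≠ v.val := fun e => ha (by rw [← Fin.ext e, (hXv u hu).1])
      have := (hXv u hu).2
      omega

/-- An intermediate state of the dynamic program. `D` is the set of the labels that are left, every
such label `a` stands for the set `U a` of vertices, and `L a` lists subsets of `U a` that are best
possible among the sets with a prescribed canonical trace on the vertices with label `a`. -/
structure IsPartialSolution (G : SimpleGraph (Fin n)) (c : Fin n → Fin n) (D : Finset (Fin n))
    (U : Fin n → Finset (Fin n)) (L : Fin n → List (Finset (Fin n))) : Prop where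
  subset : ∀ a ∈ D, ∀ X ∈ L a, X ⊆ U a
  mem_label : ∀ u, c u ∈ D → u ∈ U (c u)
  disjoint : ∀ a ∈ D, ∀ b ∈ D, a ≠ b → Disjoint (U a) (U b)
  cover : ∀ u, ∃ a ∈ D, u ∈ U a
  label_eq_of_adj : ∀ a ∈ D, ∀ b ∈ D, a ≠ b → ∀ u ∈ U a, ∀ v ∈ U b, G.Adj u v → c u = a ∧ c v = b
  exists_best : ∀ a ∈ D, ∀ Y, IsCanonical G n Y →
    ∃ X ∈ L a, (∀ u, c u = a → (u ∈ X ↔ u ∈ Y)) ∧ cutValue G (Y ∩ U a) ≤ cutValue G X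

theorem IsStateTable.isPartialSolution (hP : IsBubblePartition G P) (hc : IsLabelling P c)
    {L : Fin n → List (Finset (Fin n))} (hL : IsStateTable G c n L) :
    IsPartialSolution G c Finset.univ (fun a => Finset.univ.filter fun u => c u = a) L where
  subset a _ X hX u hu := by simpa using ((((hL a).2 X).1 hX).2 u hu).1
  mem_label u _ := by simp
  disjoint a _ b _ hab := by
    rw [Finset.disjoint_left]
    intro u hu hu'
    simp only [Finset.mem_filter, Finset.mem_univ, true_and] at hu hu'
    exact hab (hu.symm.trans hu')
  cover u := ⟨c u, Finset.mem_univ _, by simp⟩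
  label_eq_of_adj a _ b _ _ u hu v hv _ := ⟨by simpa using hu, by simpa using hv⟩
  exists_best a _ Y hY := by
    refine ⟨Y ∩ Finset.univ.filter fun u => c u = a, ((hL a).2 _).2 ⟨⟨?_, ?_⟩, ?_⟩, ?_, le_rfl⟩
    · intro u u' ht hlt hu'
      simp only [Finset.mem_inter, Finset.mem_filter, Finset.mem_univ, true_and] at hu' ⊢
      exact ⟨hY.mem_of_lt ht hlt hu'.1, (ht.label_eq hP hc).trans hu'.2⟩
    · intro u u' w w' htu htw hu hw hu' hw' hku hkw hadj
      simp only [Finset.mem_inter, Finset.mem_filter, Finset.mem_univ, true_and] at hu hw hu' hw'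
      refine hY.areTwins_of_split htu htw hu.1 hw.1 (fun h => hu' ⟨h, ?_⟩) (fun h => hw' ⟨h, ?_⟩)
        hku hkw hadj
      · rw [← htu.label_eq hP hc, hu.2]
      · rw [← htw.label_eq hP hc, hw.2]
    · intro u hu
      simp only [Finset.mem_inter, Finset.mem_filter, Finset.mem_univ, true_and] at hu
      exact ⟨hu.2, u.2⟩
    · intro u hu
      simp [hu]

/-- The edges between two groups run between the vertices labelled by the groups. -/
theorem IsPartialSolution.edgesBetween_eq {D : Finset (Fin n)} {U : Fin n → Finset (Fin n)}
    {L : Fin n → List (Finset (Fin n))} (h : IsPartialSolution G c D U L) {a b : Fin n}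
    (ha : a ∈ D) (hb : b ∈ D) (hab : a ≠ b) {X Y Z : Finset (Fin n)} (hX : X ⊆ U a) (hZ : Z ⊆ U b)
    (hXY : ∀ u, c u = a → (u ∈ X ↔ u ∈ Y)) (hZY : ∀ u, c u = b → (u ∈ Z ↔ u ∈ Y)) :
    edgesBetween G X Z = edgesBetween G (Y ∩ U a) (Y ∩ U b) := by
  classical
  have key : ∀ S T : Finset (Fin n), S ⊆ U a → T ⊆ U b → edgesBetween G S T =
      ∑ u, ∑ v, if u ∈ S ∧ v ∈ T ∧ c u = a ∧ c v = b ∧ G.Adj u v then 1 else 0 := by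
    intro S T hS hT
    unfold edgesBetween
    rw [← Finset.sum_subset (Finset.subset_univ S)]
    · refine Finset.sum_congr rfl fun u hu => ?_
      rw [← Finset.sum_subset (Finset.subset_univ T)]
      · refine Finset.sum_congr rfl fun v hv => if_congr ?_ rfl rfl
        have := h.label_eq_of_adj a ha b hb hab u (hS hu) v (hT hv)
        tauto
      · intro v _ hv
        simp [hv]
    · intro u _ hu
      simp [hu]
  rw [key X Z hX hZ, key _ _ Finset.inter_subset_right Finset.inter_subset_right]
  refine Finset.sum_congr rfl fun u _ => Finset.sum_congr rfl fun v _ => if_congr ?_ rfl rfl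
  have h1 : c u = a → u ∈ U a := fun e => e ▸ h.mem_label u (e ▸ ha)
  have h2 : c v = b → v ∈ U b := fun e => e ▸ h.mem_label v (e ▸ hb)
  have h3 := hXY u
  have h4 := hZY v
  simp only [Finset.mem_inter]
  tauto

/-- The list `l'` arises from `lb` by joining every member with a best possible member of `la`. -/
structure IsMerge (G : SimpleGraph (Fin n)) (la lb l' : List (Finset (Fin n))) : Prop where
  exists_eq : ∀ W ∈ l', ∃ X ∈ lb, ∃ Z ∈ la, W = X ∪ Z
  exists_best : ∀ X ∈ lb, ∃ W ∈ l', (∃ Z ∈ la, W = X ∪ Z) ∧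
    ∀ Z ∈ la, cutValue G (X ∪ Z) ≤ cutValue G W

theorem IsPartialSolution.merge {D : Finset (Fin n)} {U : Fin n → Finset (Fin n)}
    {L : Fin n → List (Finset (Fin n))} (h : IsPartialSolution G c D U L) {a b : Fin n}
    (hab : IsMergeable G c D a b) {l' : List (Finset (Fin n))} (hl' : IsMerge G (L a) (L b) l') :
    IsPartialSolution G c (D.erase a) (Function.update U b (U b ∪ U a))
      (Function.update L b l') := by
  obtain ⟨ha, hb, hne, hleaf⟩ := hab
  have hdisj := h.disjoint b hb a ha hne.symm
  refine ⟨?_, ?_, ?_, ?_, ?_, ?_⟩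
  · intro d hd W hW
    by_cases hdb : d = b
    · subst hdb
      rw [Function.update_self] at hW ⊢
      obtain ⟨X, hX, Z, hZ, rfl⟩ := hl'.exists_eq W hW
      exact Finset.union_subset_union (h.subset d hb X hX) (h.subset a ha Z hZ)
    · rw [Function.update_of_ne hdb] at hW ⊢
      exact h.subset d (Finset.mem_of_mem_erase hd) W hW
  · intro u hu
    have h1 := h.mem_label u (Finset.mem_of_mem_erase hu)
    by_cases hub : c u = b
    · rw [hub] at h1 ⊢
      rw [Function.update_self]
      exact Finset.mem_union_left _ h1
    · rwa [Function.update_of_ne hub]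
  · have key : ∀ d ∈ D.erase a, d ≠ b → Disjoint (U b ∪ U a) (U d) := fun d hd hdb =>
      Finset.disjoint_union_left.2 ⟨h.disjoint b hb d (Finset.mem_of_mem_erase hd) (Ne.symm hdb),
        h.disjoint a ha d (Finset.mem_of_mem_erase hd) (Finset.ne_of_mem_erase hd).symm⟩
    intro d hd e he hde
    by_cases hdb : d = b
    · subst hdb
      rw [Function.update_self, Function.update_of_ne hde.symm]
      exact key e he hde.symm
    · rw [Function.update_of_ne hdb]
      by_cases heb : e = b
      · subst heb
        rw [Function.update_self]
        exact (key d hd hdb).symm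
      · rw [Function.update_of_ne heb]
        exact h.disjoint d (Finset.mem_of_mem_erase hd) e (Finset.mem_of_mem_erase he) hde
  · intro u
    obtain ⟨d, hd, hu⟩ := h.cover u
    by_cases hda : d = a ∨ d = b
    · refine ⟨b, Finset.mem_erase.2 ⟨hne.symm, hb⟩, ?_⟩
      rw [Function.update_self, Finset.mem_union]
      rcases hda with rfl | rfl
      exacts [Or.inr hu, Or.inl hu]
    · push Not at hda
      exact ⟨d, Finset.mem_erase.2 ⟨hda.1, hd⟩, by rwa [Function.update_of_ne hda.2]⟩
  · have key : ∀ d ∈ D.erase a, d ≠ b → ∀ u ∈ U b ∪ U a, ∀ v ∈ U d, G.Adj u v →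
        c u = b ∧ c v = d := by
      intro d hd hdb u hu v hv hadj
      obtain ⟨hda, hd⟩ := Finset.mem_erase.1 hd
      rcases Finset.mem_union.1 hu with hu | hu
      · exact h.label_eq_of_adj b hb d hd (Ne.symm hdb) u hu v hv hadj
      · obtain ⟨h1, h2⟩ := h.label_eq_of_adj a ha d hd (Ne.symm hda) u hu v hv hadj
        exact absurd hadj (hleaf u v h1 (h2 ▸ hd) (h2 ▸ hda) (h2 ▸ hdb))
    intro d hd e he hde u hu v hv hadj
    by_cases hdb : d = b
    · subst hdb
      rw [Function.update_self] at hu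
      rw [Function.update_of_ne hde.symm] at hv
      exact key e he hde.symm u hu v hv hadj
    · rw [Function.update_of_ne hdb] at hu
      by_cases heb : e = b
      · subst heb
        rw [Function.update_self] at hv
        exact (key d hd hdb v hv u hu hadj.symm).symm
      · rw [Function.update_of_ne heb] at hv
        exact h.label_eq_of_adj d (Finset.mem_of_mem_erase hd) e (Finset.mem_of_mem_erase he) hde
          u hu v hv hadj
  · intro d hd Y hY
    by_cases hdb : d = b
    · subst hdb
      simp only [Function.update_self]
      obtain ⟨X, hX, hXY, hXcut⟩ := h.exists_best d hb Y hY
      obtain ⟨Z, hZ, hZY, hZcut⟩ := h.exists_best a ha Y hY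
      obtain ⟨W, hW, ⟨Z', hZ', rfl⟩, hbest⟩ := hl'.exists_best X hX
      refine ⟨_, hW, fun u hu => ?_, ?_⟩
      · rw [Finset.mem_union, ← hXY u hu, or_iff_left]
        intro hu'
        exact Finset.disjoint_left.1 hdisj (hu ▸ h.mem_label u (hu ▸ hb))
          (h.subset a ha Z' hZ' hu')
      · refine le_trans ?_ (hbest Z hZ)
        have hXs := h.subset d hb X hX
        have hZs := h.subset a ha Z hZ
        have h1 := cutValue_union G (Finset.disjoint_of_subset_left hXs
          (Finset.disjoint_of_subset_right hZs hdisj))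
        have h2 := cutValue_union G (S := Y ∩ U d) (T := Y ∩ U a)
          (Finset.disjoint_of_subset_left Finset.inter_subset_right
            (Finset.disjoint_of_subset_right Finset.inter_subset_right hdisj))
        rw [h.edgesBetween_eq hb ha hne.symm hXs hZs hXY hZY] at h1
        rw [Finset.inter_union_distrib_left]
        omega
    · simp only [Function.update_of_ne hdb]
      exact h.exists_best d (Finset.mem_of_mem_erase hd) Y hY

/-- When a single label is left, its list contains a maximum cut. -/
theorem IsPartialSolution.cutValue_le {r : Fin n} {U : Fin n → Finset (Fin n)}
    {L : Fin n → List (Finset (Fin n))} (h : IsPartialSolution G c {r} U L) {X : Finset (Fin n)}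
    (hX : ∀ Z ∈ L r, cutValue G Z ≤ cutValue G X) (S : Finset (Fin n)) :
    cutValue G S ≤ cutValue G X := by
  obtain ⟨Y, hY, hYmax⟩ := exists_isCanonical_forall_cutValue_le G
  obtain ⟨Z, hZ, -, hle⟩ := h.exists_best r (by simp) Y hY
  have hU : U r = Finset.univ := by
    ext u
    obtain ⟨a, ha, hu⟩ := h.cover u
    rw [Finset.mem_singleton] at ha
    simpa [ha] using hu
  rw [hU, Finset.inter_univ] at hle
  exact (hYmax S).trans (hle.trans (hX Z hZ))

end Merging

/-! ### Encodings and tests -/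

open RAM

open Classical in
/-- The truth value of `p`, as a number. -/
noncomputable def ind (p : Prop) : ℕ := if p then 1 else 0

theorem ind_mul (p q : Prop) : ind p * ind q = ind (p ∧ q) := by
  by_cases hp : p <;> by_cases hq : q <;> simp [ind, hp, hq]

theorem one_sub_ind (p : Prop) : 1 - ind p = ind (¬ p) := by
  by_cases hp : p <;> simp [ind, hp]

theorem ind_le_one (p : Prop) : ind p ≤ 1 := by
  by_cases hp : p <;> simp [ind, hp]

theorem ind_eq_zero {p : Prop} : ind p = 0 ↔ ¬ p := by
  by_cases hp : p <;> simp [ind, hp]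

/-- The number whose binary digits are the characteristic vector of `S`. -/
def encode {n : ℕ} (S : Finset (Fin n)) : ℕ := ∑ u ∈ S, 2 ^ u.val

theorem encode_union {n : ℕ} {S T : Finset (Fin n)} (h : Disjoint S T) :
    encode (S ∪ T) = encode S + encode T := Finset.sum_union h

theorem encode_insert {n : ℕ} {S : Finset (Fin n)} {v : Fin n} (h : v ∉ S) :
    encode (insert v S) = encode S + 2 ^ v.val := by
  rw [encode, Finset.sum_insert h, add_comm, encode]

theorem encode_lt {n : ℕ} {S : Finset (Fin n)} {k : ℕ} (h : ∀ u ∈ S, u.val < k) :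
    encode S < 2 ^ k := by
  have : encode S = ∑ i ∈ S.map Fin.valEmbedding, 2 ^ i := by simp [encode]
  rw [this]
  exact Nat.geomSum_lt le_rfl fun i hi => by
    obtain ⟨u, hu, rfl⟩ := Finset.mem_map.1 hi
    exact h u hu

theorem encode_lt_two_pow {n : ℕ} (S : Finset (Fin n)) : encode S < 2 ^ n :=
  encode_lt fun u _ => u.2

theorem encode_div_two_pow_mod_two {n : ℕ} (S : Finset (Fin n)) (u : Fin n) :
    encode S / 2 ^ u.val % 2 = ind (u ∈ S) := by
  classical
  -- the digits below, at, and above the position of `u`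
  have h1 : encode S = encode (S.filter fun v => v < u) + encode (S.filter fun v => ¬ v < u) := by
    rw [encode, ← Finset.sum_filter_add_sum_filter_not S fun v => v < u]
    rfl
  have h2 : encode (S.filter fun v => v < u) < 2 ^ u.val :=
    encode_lt fun v hv => (Finset.mem_filter.1 hv).2
  have h3 : encode (S.filter fun v => ¬ v < u)
      = 2 ^ u.val * (∑ v ∈ S.filter fun v => ¬ v < u, 2 ^ (v.val - u.val)) := by
    rw [encode, Finset.mul_sum]
    refine Finset.sum_congr rfl fun v hv => ?_
    have : u.val ≤ v.val := not_lt.1 (Finset.mem_filter.1 hv).2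
    rw [← pow_add]
    congr 1
    omega
  rw [h1, h3, Nat.add_mul_div_left _ _ (by positivity), Nat.div_eq_of_lt h2, zero_add,
    Finset.sum_nat_mod]
  have h4 : ∀ v ∈ S.filter fun v => ¬ v < u, 2 ^ (v.val - u.val) % 2 = if v = u then 1 else 0 := by
    intro v hv
    have h5 : u.val ≤ v.val := not_lt.1 (Finset.mem_filter.1 hv).2
    by_cases h6 : v = u
    · simp [h6]
    · have h7 : v.val ≠ u.val := fun e => h6 (Fin.ext e)
      obtain ⟨k, hk⟩ : ∃ k, v.val - u.val = k + 1 := ⟨v.val - u.val - 1, by omega⟩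
      rw [if_neg h6, hk, pow_succ, Nat.mul_mod_left]
  rw [Finset.sum_congr rfl h4, Finset.sum_ite_eq']
  by_cases hu : u ∈ S <;> simp [hu, ind]

/-- A bound for the numbers that the program stores, on graphs with `n` vertices. -/
abbrev maxEntry (n : ℕ) : ℕ := 2 ^ (4 * n + 4)

theorem two_mul_pow_four_le_maxEntry (n : ℕ) : 2 * n ^ 4 ≤ maxEntry n := by
  have h : n ^ 4 ≤ (2 ^ n) ^ 4 := Nat.pow_le_pow_left n.lt_two_pow_self.le 4
  rw [← pow_mul] at h
  have : maxEntry n = 16 * 2 ^ (n * 4) := by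
    rw [maxEntry, pow_add, mul_comm 4 n]; ring
  omega

theorem two_pow_le_maxEntry (n : ℕ) : 2 ^ (n + 1) ≤ maxEntry n :=
  Nat.pow_le_pow_right (by norm_num) (by omega)

theorem le_maxEntry (n : ℕ) : n ≤ maxEntry n :=
  n.lt_two_pow_self.le.trans (Nat.pow_le_pow_right (by norm_num) (by omega))

theorem sq_lt_maxEntry (n : ℕ) : n ^ 2 < maxEntry n := by
  have h : n ^ 2 ≤ (2 ^ n) ^ 2 := Nat.pow_le_pow_left n.lt_two_pow_self.le 2
  rw [← pow_mul] at h
  exact h.trans_lt (Nat.pow_lt_pow_right (by norm_num) (by omega))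

section Tests

/-- The expression `1 - e`, the negation of a truth value. -/
def notE (e : Expr) : Expr := .op .sub (.const 1) e

/-- The truth value of `e = f`. -/
def eqE (e f : Expr) : Expr := notE (.op .add (.op .sub e f) (.op .sub f e))

/-- The truth value of `e < f`. -/
def ltE (e f : Expr) : Expr := notE (notE (.op .sub f e))

/-- The conjunction of two truth values. -/
def andE (e f : Expr) : Expr := .op .mul e f

variable (m : Memory) (e f : Expr)

theorem eval_notE : (notE e).eval m = 1 - e.eval m := rfl

theorem eval_andE : (andE e f).eval m = e.eval m * f.eval m := rfl

theorem eval_eqE : (eqE e f).eval m = ind (e.eval m = f.eval m) := by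
  simp only [eqE, notE, Expr.eval, Op.eval]
  by_cases h : e.eval m = f.eval m
  · simp [h, ind]
  · simp only [ind, h, if_false]
    omega

theorem eval_ltE : (ltE e f).eval m = ind (e.eval m < f.eval m) := by
  simp only [ltE, notE, Expr.eval, Op.eval]
  by_cases h : e.eval m < f.eval m
  · simp only [ind, h, if_true]
    omega
  · simp only [ind, h, if_false]
    omega

end Tests

/-! ### The memory layout -/

/-- Array `1` of the input, the adjacency matrix. -/
abbrev adjA : ℕ := 1
/-- Array `2` of the input, the labels. -/
abbrev labelA : ℕ := 2
/-- Array `3`, the output. -/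
abbrev outA : ℕ := 3
/-- The powers of two. -/
abbrev powA : ℕ := 4
/-- The matrix of the twin relation. -/
abbrev twinA : ℕ := 5
/-- The lengths of the lists in `listA`. -/
abbrev lenA : ℕ := 6
/-- For every label `a` a list of sets, with its `j`-th member in cell `j * n + a`. -/
abbrev listA : ℕ := 7
/-- Marks for the labels that have been merged into another one. -/
abbrev deadA : ℕ := 8
/-- A buffer for a list of sets. -/
abbrev tmpA : ℕ := 9
/-- The register for sums. -/
abbrev accR : ℕ := 10
/-- The first counter of a sum. -/
abbrev xR : ℕ := 11
/-- The second counter of a sum. -/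
abbrev yR : ℕ := 12
/-- The third counter of a sum. -/
abbrev zR : ℕ := 13
/-- The fourth counter of a sum. -/
abbrev wR : ℕ := 14
/-- A counter of vertices or labels. -/
abbrev vR : ℕ := 15
/-- A counter of vertices or labels. -/
abbrev uR : ℕ := 16
/-- A counter of list positions. -/
abbrev iR : ℕ := 17
/-- A counter of list positions. -/
abbrev jR : ℕ := 18
/-- The length of the list in `tmpA`. -/
abbrev tmpLenR : ℕ := 19
/-- The set under consideration. -/
abbrev setR : ℕ := 20
/-- The best cut size so far. -/
abbrev bestR : ℕ := 21
/-- The best set so far. -/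
abbrev bestSetR : ℕ := 22
/-- A set to be joined with the members of a list. -/
abbrev baseR : ℕ := 23
/-- The label that is merged into another one. -/
abbrev fromR : ℕ := 24
/-- The label into which another one is merged. -/
abbrev intoR : ℕ := 25
/-- The counter of merges. -/
abbrev roundR : ℕ := 26

/-- The entry of the matrix `a` in row `i` and column `j`. -/
abbrev matE (a : ℕ) (i j : Expr) : Expr := .cell a (.op .add (.op .mul i (reg 0)) j)

/-- The truth value of `u ∈ S`, for the set `S` with code `e`: the digit `u` of `e`. -/
def bitE (e u : Expr) : Expr :=
  .op .sub (.op .div e (.cell powA u))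
    (.op .mul (.const 2) (.op .div (.op .div e (.cell powA u)) (.const 2)))

variable {n : ℕ} {G : SimpleGraph (Fin n)} {c : Fin n → Fin n}

/-- The memory `m` holds the input. -/
structure HasInput (G : SimpleGraph (Fin n)) (c : Fin n → Fin n) (m : Memory) : Prop where
  size : m 0 0 = n
  adj : ∀ u v : Fin n, m adjA (u.val * n + v.val) = ind (G.Adj u v)
  label : ∀ u : Fin n, m labelA u.val = (c u).val

/-- The memory `m` holds the powers of two. -/
def HasPowers (n : ℕ) (m : Memory) : Prop := ∀ u : Fin n, m powA u.val = 2 ^ u.val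

/-- The memory `m` holds the matrix of the twin relation. -/
def HasTwins (G : SimpleGraph (Fin n)) (m : Memory) : Prop :=
  ∀ u v : Fin n, m twinA (u.val * n + v.val) = ind (AreTwins G u v)

/-- The memory `m` holds the input, the powers of two and the twin relation. -/
structure HasData (G : SimpleGraph (Fin n)) (c : Fin n → Fin n) (m : Memory) : Prop where
  input : HasInput G c m
  powers : HasPowers n m
  twins : HasTwins G m

theorem HasInput.congr {m m' : Memory} {F : Finset ℕ} (h : HasInput G c m) (h' : AgreeOff F m m')
    (hF : Disjoint {0, adjA, labelA} F) : HasInput G c m' := by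
  have key : ∀ a ∈ ({0, adjA, labelA} : Finset ℕ), m' a = m a := fun a ha =>
    h' a (Finset.disjoint_left.1 hF ha)
  refine ⟨?_, fun u v => ?_, fun u => ?_⟩
  · rw [key 0 (by decide), h.size]
  · rw [key adjA (by decide), h.adj]
  · rw [key labelA (by decide), h.label]

theorem HasData.congr {m m' : Memory} {F : Finset ℕ} (h : HasData G c m) (h' : AgreeOff F m m')
    (hF : Disjoint {0, adjA, labelA, powA, twinA} F) : HasData G c m' := by
  refine ⟨h.input.congr h' (Finset.disjoint_of_subset_left (by decide) hF), fun u => ?_,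
    fun u v => ?_⟩
  · rw [h' powA (Finset.disjoint_left.1 hF (by decide)), h.powers]
  · rw [h' twinA (Finset.disjoint_left.1 hF (by decide)), h.twins]

theorem eval_bitE {m : Memory} (hm : HasPowers n m) {e f : Expr} {S : Finset (Fin n)} {u : Fin n}
    (he : e.eval m = encode S) (hf : f.eval m = u.val) : (bitE e f).eval m = ind (u ∈ S) := by
  rw [← encode_div_two_pow_mod_two]
  simp only [bitE, Expr.eval, Op.eval, he, hf, hm u]
  omega

/-- `acc := cutValue G S`, for the set `S` in `setR`. -/
def cutProg : Program :=
  sumProg₂ accR xR yR (andE (andE (bitE (reg setR) (reg xR)) (notE (bitE (reg setR) (reg yR))))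
    (matE adjA (reg xR) (reg yR)))

theorem cutValue_eq_sum_ind (S : Finset (Fin n)) :
    cutValue G S = ∑ u, ∑ v, ind ((u ∈ S ∧ v ∉ S) ∧ G.Adj u v) := by
  unfold cutValue edgesBetween
  rw [← Finset.sum_subset (Finset.subset_univ S)]
  · refine Finset.sum_congr rfl fun u hu => ?_
    rw [← Finset.sum_subset (Finset.subset_univ Sᶜ)]
    · refine Finset.sum_congr rfl fun v hv => ?_
      rw [Finset.mem_compl] at hv
      unfold ind
      split_ifs <;> tauto
    · intro v _ hv
      rw [Finset.mem_compl, not_not] at hv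
      simp [ind, hv]
  · intro u _ hu
    simp [ind, hu]

theorem sum_sum_ind_le (p : Fin n → Fin n → Prop) : ∑ u, ∑ v, ind (p u v) ≤ n ^ 2 := by
  calc ∑ u, ∑ v, ind (p u v) ≤ ∑ _u : Fin n, ∑ _v : Fin n, 1 :=
        Finset.sum_le_sum fun u _ => Finset.sum_le_sum fun v _ => ind_le_one _
    _ = n ^ 2 := by simp [sq]

theorem cutValue_lt_maxEntry (S : Finset (Fin n)) : cutValue G S < maxEntry n := by
  rw [cutValue_eq_sum_ind]
  exact (sum_sum_ind_le _).trans_lt (sq_lt_maxEntry n)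

theorem haltsIn_cutProg {m : Memory} (hm : HasData G c m) {S : Finset (Fin n)}
    (hS : m setR 0 = encode S) :
    HaltsIn (maxEntry n) cutProg m (3 * n ^ 2 + 4 * n + 3) fun m' =>
      m' accR 0 = cutValue G S ∧ AgreeOff {xR, yR, accR} m m' := by
  refine (haltsIn_sumProg₂ (g := fun u v : Fin n => ind ((u ∈ S ∧ v ∉ S) ∧ G.Adj u v)) (by decide)
    hm.input.size (le_maxEntry n) ?_ ?_).mono le_rfl fun m' h => ?_
  · intro u v m' h hu hv
    have hm' := hm.congr h (by decide)
    have hS' : (reg setR).eval m' = encode S := by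
      simp only [Expr.eval]
      rw [h setR (by decide), hS]
    rw [eval_andE, eval_andE, eval_notE, eval_bitE hm'.powers hS' (f := reg xR) (u := u) hu,
      eval_bitE hm'.powers hS' (f := reg yR) (u := v) hv, one_sub_ind, ind_mul]
    simp only [Expr.eval, Op.eval, hu, hv, hm'.input.size, hm'.input.adj]
    rw [ind_mul]
  · exact (sum_sum_ind_le _).trans (sq_lt_maxEntry n).le
  · rwa [cutValue_eq_sum_ind]

/-- `acc := 0` if the set in `setR` is canonical up to `v + 1`, where `v` is the content of `vR`;
otherwise, `acc` receives a positive number. -/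
def canonicalProg : Program :=
  sumProg₄ accR xR yR zR wR (.op .add
    (andE (andE (matE twinA (reg xR) (reg yR)) (ltE (reg xR) (reg yR)))
      (andE (bitE (reg setR) (reg yR)) (notE (bitE (reg setR) (reg xR)))))
    (andE
      (andE
        (andE (matE twinA (reg xR) (reg yR)) (matE twinA (reg zR) (reg wR)))
        (andE (bitE (reg setR) (reg xR)) (bitE (reg setR) (reg zR))))
      (andE
        (andE
          (andE (notE (bitE (reg setR) (reg yR))) (notE (bitE (reg setR) (reg wR))))
          (andE (ltE (reg yR) (.op .add (reg vR) (.const 1)))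
            (ltE (reg wR) (.op .add (reg vR) (.const 1)))))
        (andE (matE adjA (reg xR) (reg zR)) (notE (matE twinA (reg xR) (reg zR)))))))

/-- The number of violations of the conditions on canonical sets by four vertices. -/
noncomputable def violation (G : SimpleGraph (Fin n)) (k : ℕ) (S : Finset (Fin n))
    (u u' w w' : Fin n) : ℕ :=
  ind ((AreTwins G u u' ∧ u.val < u'.val) ∧ u' ∈ S ∧ u ∉ S) +
    ind (((AreTwins G u u' ∧ AreTwins G w w') ∧ u ∈ S ∧ w ∈ S) ∧
      ((u' ∉ S ∧ w' ∉ S) ∧ u'.val < k ∧ w'.val < k) ∧ G.Adj u w ∧ ¬ AreTwins G u w)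

theorem sum_violation_eq_zero {k : ℕ} {S : Finset (Fin n)} :
    ∑ u, ∑ u', ∑ w, ∑ w', violation G k S u u' w w' = 0 ↔ IsCanonical G k S := by
  simp only [Finset.sum_eq_zero_iff, Finset.mem_univ, true_imp_iff, violation, add_eq_zero,
    ind_eq_zero]
  constructor
  · intro h
    refine ⟨fun u u' ht hlt hu' => ?_, fun u u' w w' htu htw hu hw hu' hw' hku hkw hadj => ?_⟩
    · have := (h u u' u u').1
      by_contra hu
      exact this ⟨⟨ht, hlt⟩, hu', hu⟩
    · have := (h u u' w w').2
      by_contra hn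
      exact this ⟨⟨⟨htu, htw⟩, hu, hw⟩, ⟨⟨hu', hw'⟩, hku, hkw⟩, hadj, hn⟩
  · intro h u u' w w'
    constructor
    · rintro ⟨⟨ht, hlt⟩, hu', hu⟩
      exact hu (h.mem_of_lt ht hlt hu')
    · rintro ⟨⟨⟨htu, htw⟩, hu, hw⟩, ⟨⟨hu', hw'⟩, hku, hkw⟩, hadj, hn⟩
      exact hn (h.areTwins_of_split htu htw hu hw hu' hw' hku hkw hadj)

/-- A bound for the number of elementary steps of `canonicalProg`. -/
abbrev canonicalCost (n : ℕ) : ℕ := 3 * n ^ 4 + 4 * n ^ 3 + 4 * n ^ 2 + 4 * n + 3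

theorem haltsIn_canonicalProg {m : Memory} (hm : HasData G c m) {S : Finset (Fin n)}
    (hS : m setR 0 = encode S) {v : ℕ} (hv : m vR 0 = v) :
    HaltsIn (maxEntry n) canonicalProg m (canonicalCost n) fun m' =>
      (m' accR 0 = 0 ↔ IsCanonical G (v + 1) S) ∧ AgreeOff {xR, yR, zR, wR, accR} m m' := by
  refine (haltsIn_sumProg₄ (g := violation G (v + 1) S) (by decide)
    hm.input.size (le_maxEntry n) ?_ ?_).mono le_rfl fun m' h => ?_
  · intro u u' w w' m' h hu hu' hw hw'
    have hm' := hm.congr h (by decide)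
    have hS' : (reg setR).eval m' = encode S := by
      simp only [Expr.eval]
      rw [h setR (by decide), hS]
    have hv' : m' vR 0 = v := by rw [h vR (by decide), hv]
    have h1 := eval_bitE hm'.powers hS' (f := reg xR) (u := u) hu
    have h2 := eval_bitE hm'.powers hS' (f := reg yR) (u := u') hu'
    have h3 := eval_bitE hm'.powers hS' (f := reg zR) (u := w) hw
    have h4 := eval_bitE hm'.powers hS' (f := reg wR) (u := w') hw'
    have h5 := hm'.twins
    unfold HasTwins at h5
    simp only [Expr.eval, Op.eval, eval_andE, eval_notE, eval_ltE, h1, h2, h3, h4, h5, hu, hu', hw,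
      hw', hv', hm'.input.size, hm'.input.adj, one_sub_ind, ind_mul, violation]
  · have key : ∀ u u' w w', violation G (v + 1) S u u' w w' ≤ 2 := fun u u' w w' =>
      add_le_add (ind_le_one _) (ind_le_one _)
    calc ∑ u, ∑ u', ∑ w, ∑ w', violation G (v + 1) S u u' w w'
        ≤ ∑ _u : Fin n, ∑ _u' : Fin n, ∑ _w : Fin n, ∑ _w' : Fin n, 2 :=
          Finset.sum_le_sum fun u _ => Finset.sum_le_sum fun u' _ => Finset.sum_le_sum fun w _ =>
            Finset.sum_le_sum fun w' _ => key u u' w w'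
      _ = 2 * n ^ 4 := by simp; ring
      _ ≤ maxEntry n := two_mul_pow_four_le_maxEntry n
  · rw [← sum_violation_eq_zero, ← h.1]
    exact ⟨Iff.rfl, h.2⟩

/-! ### Listing the canonical sets -/

variable {P : Finpartition (Finset.univ : Finset (Fin n))}

/-- The cells `0, 1, …` of `f` hold the codes of the members of `l`. -/
def Holds (f : ℕ → ℕ) (l : List (Finset (Fin n))) : Prop :=
  ∀ (j : ℕ) (h : j < l.length), f j = encode l[j]

theorem holds_append_singleton {f g : ℕ → ℕ} {l : List (Finset (Fin n))} {S : Finset (Fin n)}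
    (h : Holds f l) (hg : ∀ j < l.length, g j = f j) (hS : g l.length = encode S) :
    Holds g (l ++ [S]) := by
  intro j hj
  rw [List.length_append, List.length_singleton] at hj
  rw [List.getElem_append]
  split_ifs with hlt
  · rw [hg j hlt, h j hlt]
  · obtain rfl : j = l.length := by omega
    simpa using hS

/-- The memory `m` holds the table `L`. -/
def HasTable (L : Fin n → List (Finset (Fin n))) (m : Memory) : Prop :=
  ∀ a : Fin n, m lenA a.val = (L a).length ∧ Holds (fun j => m listA (j * n + a.val)) (L a)

theorem HasTable.congr {L : Fin n → List (Finset (Fin n))} {m m' : Memory} {F : Finset ℕ}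
    (h : HasTable L m) (h' : AgreeOff F m m') (hF : Disjoint {lenA, listA} F) :
    HasTable L m' := by
  have h1 := h' lenA (Finset.disjoint_left.1 hF (by decide))
  have h2 := h' listA (Finset.disjoint_left.1 hF (by decide))
  intro a
  rw [h1, h2]
  exact h a

theorem mul_add_inj {i j : ℕ} {a b : Fin n} (h : i * n + a.val = j * n + b.val) :
    i = j ∧ a = b := by
  have ha := a.2
  have hn : 0 < n := by omega
  have h1 : (i * n + a.val) / n = (j * n + b.val) / n := by rw [h]
  have h2 : (i * n + a.val) % n = (j * n + b.val) % n := by rw [h]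
  rw [mul_comm i, mul_comm j, Nat.mul_add_div hn, Nat.mul_add_div hn, Nat.div_eq_of_lt ha,
    Nat.div_eq_of_lt b.2] at h1
  rw [mul_comm i, mul_comm j, Nat.mul_add_mod, Nat.mul_add_mod, Nat.mod_eq_of_lt ha,
    Nat.mod_eq_of_lt b.2] at h2
  exact ⟨by omega, Fin.ext h2⟩

/-- Append the set in `setR` to the list in `tmpA`, if it is canonical up to `v + 1`. -/
def appendProg : Program :=
  .seq canonicalProg (.ite (reg accR) .skip
    (.seq (.write tmpA (reg tmpLenR) (reg setR))
      (setReg tmpLenR (.op .add (reg tmpLenR) (.const 1)))))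

open Classical in
theorem haltsIn_appendProg {m : Memory} (hm : HasData G c m) {S : Finset (Fin n)}
    (hS : m setR 0 = encode S) {v : ℕ} (hv : m vR 0 = v) {l : List (Finset (Fin n))}
    (hl : Holds (m tmpA) l) (hlen : m tmpLenR 0 = l.length) (hlt : l.length < maxEntry n) :
    HaltsIn (maxEntry n) appendProg m (canonicalCost n + 3) fun m' =>
      Holds (m' tmpA) (l ++ [S].filter fun Y => IsCanonical G (v + 1) Y) ∧
      m' tmpLenR 0 = (l ++ [S].filter fun Y => IsCanonical G (v + 1) Y).length ∧
      AgreeOff {xR, yR, zR, wR, accR, tmpA, tmpLenR} m m' := by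
  refine HaltsIn.seq ((haltsIn_canonicalProg hm hS hv).mono le_rfl ?_)
  rintro m₁ ⟨hacc, h₁⟩
  have hS₁ : m₁ setR 0 = encode S := by rw [h₁ setR (by decide), hS]
  have hlen₁ : m₁ tmpLenR 0 = l.length := by rw [h₁ tmpLenR (by decide), hlen]
  have ht₁ : m₁ tmpA = m tmpA := h₁ tmpA (by decide)
  have hF : AgreeOff {xR, yR, zR, wR, accR, tmpA, tmpLenR} m m₁ := h₁.mono (by decide)
  refine HaltsIn.ite (T := 2) (fun h => ?_) fun h => ?_
  · have hS : ¬ IsCanonical G (v + 1) S := fun hc => h (hacc.2 hc)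
    refine (HaltsIn.skip ?_).mono one_le_two fun _ h => h
    simp only [List.filter_cons, hS, decide_false, List.filter_nil, Bool.false_eq_true, if_false,
      List.append_nil]
    exact ⟨by rwa [ht₁], hlen₁, hF⟩
  · have hS : IsCanonical G (v + 1) S := hacc.1 h
    simp only [List.filter_cons, hS, decide_true, List.filter_nil, if_true]
    refine HaltsIn.seq (HaltsIn.write ?_ (HaltsIn.write ?_ ⟨?_, ?_, ?_⟩))
    · simp only [Expr.eval, hS₁]
      exact (encode_lt_two_pow S).le.trans (Nat.pow_le_pow_right (by norm_num) (by omega))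
    · simp only [Expr.eval, Op.eval, Memory.set_of_ne _ (show tmpLenR ≠ tmpA by decide), hlen₁]
      omega
    · rw [Memory.set_of_ne _ (by decide)]
      simp only [Expr.eval, hS₁, hlen₁]
      refine holds_append_singleton hl (fun j hj => ?_) (Memory.set_self _ _ _ _)
      rw [Memory.set, if_neg (by omega), ht₁]
    · simp only [Expr.eval, Op.eval, Memory.set_self,
        Memory.set_of_ne _ (show tmpLenR ≠ tmpA by decide), hlen₁, List.length_append,
        List.length_singleton]
    · exact (hF.set (by decide) _ _).set (by decide) _ _

/-- The label of the vertex in `vR`. -/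
abbrev labelE : Expr := .cell labelA (reg vR)

/-- Replace the list `l` for the label of `v` by `extendStates G v l`, where `v` is the vertex in
`vR`. -/
def extendProg : Program :=
  .seq (setReg tmpLenR (.const 0)) <|
  .seq (forLoop iR (.cell lenA labelE)
    (.seq (setReg setR (matE listA (reg iR) labelE)) <|
      .seq appendProg <|
      .seq (setReg setR (.op .add (reg setR) (.cell powA (reg vR)))) appendProg)) <|
  .seq (forLoop iR (reg tmpLenR)
    (.write listA (.op .add (.op .mul (reg iR) (reg 0)) labelE) (.cell tmpA (reg iR))))
    (.write lenA labelE (reg tmpLenR))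

theorem length_extendStates_le (v : Fin n) (l : List (Finset (Fin n))) :
    (extendStates G v l).length ≤ 2 * l.length := by
  classical
  induction l with
  | nil => simp [extendStates]
  | cons X l ih =>
    rw [extendStates, List.flatMap_cons, List.length_append, ← extendStates, List.length_cons]
    have : ([X, insert v X].filter fun Y => IsCanonical G (v.val + 1) Y).length ≤ 2 :=
      List.length_filter_le _ _
    omega

open Classical in
theorem extendStates_take_succ (v : Fin n) (l : List (Finset (Fin n))) {k : ℕ}
    (hk : k < l.length) :
    extendStates G v (l.take (k + 1)) = extendStates G v (l.take k)
      ++ ([l[k]].filter fun Y => IsCanonical G (v.val + 1) Y)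
      ++ ([insert v l[k]].filter fun Y => IsCanonical G (v.val + 1) Y) := by
  rw [← List.take_concat_get' l k hk]
  simp only [extendStates, List.flatMap_append, List.flatMap_cons, List.flatMap_nil,
    List.append_nil, List.append_assoc, ← List.filter_append]
  rfl

/-- The arrays changed by `extendProg`. -/
abbrev extendFrame : Finset ℕ := {xR, yR, zR, wR, accR, tmpA, tmpLenR, setR, iR, lenA, listA}

theorem haltsIn_extendProg {m : Memory} (hm : HasData G c m) {v : Fin n} (hv : m vR 0 = v.val)
    {L : Fin n → List (Finset (Fin n))} (hL : HasTable L m) (hlen : (L (c v)).length ≤ 2 ^ n)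
    (hmem : ∀ X ∈ L (c v), v ∉ X) :
    HaltsIn (maxEntry n) extendProg m ((L (c v)).length * (2 * canonicalCost n + 16) + 6) fun m' =>
      HasTable (Function.update L (c v) (extendStates G v (L (c v)))) m' ∧
      AgreeOff extendFrame m m' := by
  classical
  set l := L (c v) with hl
  set l' := extendStates G v l with hl'
  have hll' : l'.length ≤ 2 * l.length := length_extendStates_le v l
  have hpow := two_pow_le_maxEntry n
  rw [pow_succ] at hpow
  refine HaltsIn.mono (T := 1 + ((l.length * (2 * canonicalCost n + 8 + 2) + 2) +
    ((l'.length * (1 + 2) + 2) + 1))) ?_ (by nlinarith) fun _ h => h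
  refine HaltsIn.seq (HaltsIn.write (by simp [Expr.eval]) (HaltsIn.seq ?_))
  simp only [Expr.eval]
  -- the frame of the first loop
  let F : Finset ℕ := {xR, yR, zR, wR, accR, tmpA, tmpLenR, setR, iR}
  refine HaltsIn.forLoop (N := l.length) (T := 2 * canonicalCost n + 8) (fun k m' =>
    AgreeOff F m m' ∧ Holds (m' tmpA) (extendStates G v (l.take k)) ∧
      m' tmpLenR 0 = (extendStates G v (l.take k)).length) (by omega) ?_ ?_ ?_ ?_
  · refine ⟨(((AgreeOff.refl F m).set (by decide) _ _).set (by decide) _ _), ?_, ?_⟩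
    · intro j hj
      simp [extendStates] at hj
    · rw [Memory.set_of_ne _ (by decide), Memory.set_self]
      simp [extendStates]
  · rintro k - m' ⟨h, -, -⟩ -
    simp only [Expr.eval, h vR (by decide), hv, (hm.congr h (by decide)).input.label,
      ((hL.congr h (by decide)) (c v)).1]
    rfl
  · rintro k hk m₁ hi ⟨h₁, htmp₁, htl₁⟩
    have hd₁ := hm.congr h₁ (by decide)
    have hv₁ : m₁ vR 0 = v.val := by rw [h₁ vR (by decide), hv]
    have hX : m₁ listA (k * n + (c v).val) = encode l[k] :=
      ((hL.congr h₁ (by decide)) (c v)).2 k hk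
    have hvX : v ∉ l[k] := hmem _ (List.getElem_mem hk)
    have hlen₁ : (extendStates G v (l.take k)).length ≤ 2 * k :=
      (length_extendStates_le v _).trans (by rw [List.length_take]; omega)
    refine HaltsIn.mono (T := 1 + ((canonicalCost n + 3) + (1 + (canonicalCost n + 3)))) ?_
      (by omega) fun _ h => h
    have e₁ : (matE listA (reg iR) labelE).eval m₁ = encode l[k] := by
      simp only [Expr.eval, Op.eval, hi, hv₁, hd₁.input.size, hd₁.input.label, hX]
    refine HaltsIn.seq (HaltsIn.write ?_ (HaltsIn.seq ?_))
    · rw [e₁]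
      exact (encode_lt_two_pow _).le.trans (by omega)
    rw [e₁]
    have h₂ : AgreeOff {setR} m₁ (m₁.set setR 0 (encode l[k])) :=
      (AgreeOff.refl _ _).set (by decide) _ _
    refine (haltsIn_appendProg (hd₁.congr h₂ (by decide)) (Memory.set_self _ _ _ _)
      (v := v.val) (by rw [Memory.set_of_ne _ (by decide), hv₁])
      (l := extendStates G v (l.take k)) (by rwa [Memory.set_of_ne _ (by decide)])
      (by rw [Memory.set_of_ne _ (by decide), htl₁]) (by omega)).mono le_rfl ?_
    rintro m₃ ⟨htmp₃, htl₃, h₃⟩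
    have h₃' : AgreeOff {xR, yR, zR, wR, accR, tmpA, tmpLenR, setR} m₁ m₃ :=
      (h₂.mono (by decide)).trans (h₃.mono (by decide))
    have hd₃ := hd₁.congr h₃' (by decide)
    have hv₃ : m₃ vR 0 = v.val := by rw [h₃' vR (by decide), hv₁]
    have e₃ : (Expr.op .add (reg setR) (.cell powA (reg vR))).eval m₃
        = encode (insert v l[k]) := by
      have : m₃ setR 0 = encode l[k] := by rw [h₃ setR (by decide), Memory.set_self]
      simp only [Expr.eval, Op.eval, this, hv₃, hd₃.powers v, encode_insert hvX]
    refine HaltsIn.seq (HaltsIn.write ?_ ?_)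
    · rw [e₃]
      exact (encode_lt_two_pow _).le.trans (by omega)
    rw [e₃]
    have h₄ : AgreeOff {setR} m₃ (m₃.set setR 0 (encode (insert v l[k]))) :=
      (AgreeOff.refl _ _).set (by decide) _ _
    refine (haltsIn_appendProg (hd₃.congr h₄ (by decide)) (Memory.set_self _ _ _ _)
      (v := v.val) (by rw [Memory.set_of_ne _ (by decide), hv₃])
      (l := extendStates G v (l.take k) ++ [l[k]].filter fun Y => IsCanonical G (v.val + 1) Y)
      (by rwa [Memory.set_of_ne _ (by decide)])
      (by rw [Memory.set_of_ne _ (by decide), htl₃]) ?_).mono le_rfl ?_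
    · have : ([l[k]].filter fun Y => IsCanonical G (v.val + 1) Y).length ≤ 1 :=
        List.length_filter_le _ _
      rw [List.length_append]
      omega
    rintro m₅ ⟨htmp₅, htl₅, h₅⟩
    have h₅' : AgreeOff {xR, yR, zR, wR, accR, tmpA, tmpLenR, setR} m₁ m₅ :=
      h₃'.trans ((h₄.mono (by decide)).trans (h₅.mono (by decide)))
    refine ⟨by rw [h₅' iR (by decide), hi], ?_, ?_, ?_⟩
    · exact (h₁.trans (h₅'.mono (by decide))).set (by decide) _ _
    · rw [Memory.set_of_ne _ (by decide), extendStates_take_succ v l hk]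
      exact htmp₅
    · rw [Memory.set_of_ne _ (by decide), extendStates_take_succ v l hk]
      exact htl₅
  rintro m₁ - ⟨h₁, htmp₁, htl₁⟩
  rw [List.take_length] at htmp₁ htl₁
  have hd₁ := hm.congr h₁ (by decide)
  have hv₁ : m₁ vR 0 = v.val := by rw [h₁ vR (by decide), hv]
  have hL₁ := hL.congr h₁ (by decide)
  refine HaltsIn.seq (HaltsIn.forLoop (N := l'.length) (T := 1) (fun k m' =>
    AgreeOff {iR, listA} m₁ m' ∧ (∀ j < k, m' listA (j * n + (c v).val) = m₁ tmpA j) ∧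
      ∀ j, ∀ b : Fin n, b ≠ c v → m' listA (j * n + b.val) = m₁ listA (j * n + b.val))
    (by omega) ?_ ?_ ?_ ?_)
  · exact ⟨(AgreeOff.refl _ _).set (by decide) _ _, fun j hj => absurd hj (Nat.not_lt_zero _),
      fun j b _ => by rw [Memory.set_of_ne _ (by decide)]⟩
  · rintro k - m' ⟨h, -, -⟩ -
    simp only [Expr.eval, h tmpLenR (by decide), htl₁, hl']
  · rintro k hk m₂ hi ⟨h₂, hnew, hold⟩
    have hd₂ := hd₁.congr h₂ (by decide)
    have hv₂ : m₂ vR 0 = v.val := by rw [h₂ vR (by decide), hv₁]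
    have e₁ : (Expr.op .add (.op .mul (reg iR) (reg 0)) labelE).eval m₂ = k * n + (c v).val := by
      simp only [Expr.eval, Op.eval, hi, hv₂, hd₂.input.size, hd₂.input.label]
    have e₂ : (Expr.cell tmpA (reg iR)).eval m₂ = m₁ tmpA k := by
      simp only [Expr.eval, hi, h₂ tmpA (by decide)]
    refine HaltsIn.write ?_ ?_
    · rw [e₂, htmp₁ k hk]
      exact (encode_lt_two_pow _).le.trans (by omega)
    rw [e₁, e₂]
    refine ⟨by rw [Memory.set_of_ne _ (by decide), hi], ?_, fun j hj => ?_, fun j b hb => ?_⟩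
    · exact (h₂.set (by decide) _ _).set (by decide) _ _
    · rw [Memory.set_of_ne _ (by decide), Memory.set]
      split_ifs with hjk
      · rw [(mul_add_inj hjk.2).1]
      · refine hnew j (lt_of_le_of_ne (Nat.lt_succ_iff.1 hj) ?_)
        rintro rfl
        exact hjk ⟨rfl, rfl⟩
    · rw [Memory.set_of_ne _ (by decide), Memory.set,
        if_neg fun h => hb (mul_add_inj h.2).2, hold j b hb]
  rintro m₂ - ⟨h₂, hnew, hold⟩
  have hd₂ := hd₁.congr h₂ (by decide)
  have hv₂ : m₂ vR 0 = v.val := by rw [h₂ vR (by decide), hv₁]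
  have e₁ : labelE.eval m₂ = (c v).val := by
    simp only [Expr.eval, hv₂, hd₂.input.label]
  have e₂ : (reg tmpLenR).eval m₂ = l'.length := by
    simp only [Expr.eval, h₂ tmpLenR (by decide), htl₁, hl']
  refine HaltsIn.write ?_ ?_
  · rw [e₂]
    omega
  rw [e₁, e₂]
  refine ⟨fun a => ?_, ?_⟩
  · rw [Memory.set_of_ne _ (show listA ≠ lenA by decide)]
    by_cases ha : a = c v
    · subst ha
      rw [Function.update_self, Memory.set_self]
      exact ⟨rfl, fun j hj => (hnew j hj).trans (htmp₁ j hj)⟩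
    · rw [Function.update_of_ne ha, Memory.set, if_neg fun h => ha (Fin.ext h.2),
        h₂ lenA (by decide)]
      exact ⟨(hL₁ a).1, fun j hj => (hold j a ha).trans ((hL₁ a).2 j hj)⟩
  · exact ((h₁.mono (by decide)).trans (h₂.mono (by decide))).set (by decide) _ _

/-- Fill the table of the canonical sets with a given label. -/
def buildProg : Program :=
  .seq (forLoop vR (reg 0) (.write lenA (reg vR) (.const 1))) (forLoop vR (reg 0) extendProg)

theorem haltsIn_buildProg (hP : IsBubblePartition G P) (hc : IsLabelling P c) {m : Memory}
    (hm : HasData G c m) (hlist : ∀ i, m listA i = 0) :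
    HaltsIn (maxEntry n) buildProg m
      (n * (stateBound G P * (2 * canonicalCost n + 16) + 11) + 4) fun m' =>
      (∃ L, IsStateTable G c n L ∧ HasTable L m') ∧ AgreeOff (insert vR extendFrame) m m' := by
  have hn := le_maxEntry n
  refine HaltsIn.mono (T := (n * (1 + 2) + 2) +
    (n * ((stateBound G P * (2 * canonicalCost n + 16) + 6) + 2) + 2)) ?_
    (le_of_eq (by ring)) fun _ h => h
  refine HaltsIn.seq (HaltsIn.forLoop (N := n) (T := 1) (fun k m' =>
    AgreeOff {vR, lenA} m m' ∧ ∀ j < k, m' lenA j = 1) hn ?_ ?_ ?_ ?_)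
  · exact ⟨(AgreeOff.refl _ _).set (by decide) _ _, fun j hj => absurd hj (Nat.not_lt_zero _)⟩
  · rintro k - m' ⟨h, -⟩ -
    simp only [Expr.eval, h 0 (by decide), hm.input.size]
  · rintro k hk m₁ hv ⟨h₁, hlen⟩
    refine HaltsIn.write (by simp only [Expr.eval]; exact Nat.one_le_two_pow) ?_
    simp only [Expr.eval, hv]
    refine ⟨by rw [Memory.set_of_ne _ (by decide), hv],
      (h₁.set (by decide) _ _).set (by decide) _ _, fun j hj => ?_⟩
    rw [Memory.set_of_ne _ (by decide), Memory.set]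
    split_ifs with hjk
    · rfl
    · exact hlen j (by omega)
  rintro m₁ - ⟨h₁, hlen₁⟩
  have hd₁ := hm.congr h₁ (by decide)
  refine HaltsIn.forLoop (N := n) (fun k m' => AgreeOff (insert vR extendFrame) m₁ m' ∧
    ∃ L, IsStateTable G c k L ∧ HasTable L m') hn ?_ ?_ ?_ ?_
  · have h₂ : AgreeOff {vR} m₁ (m₁.set vR 0 0) := (AgreeOff.refl _ _).set (by decide) _ _
    refine ⟨h₂.mono (by decide), _, isStateTable_zero, HasTable.congr (fun a => ⟨?_, ?_⟩) h₂
      (by decide)⟩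
    · simpa using hlen₁ a.val a.2
    · intro j hj
      obtain rfl : j = 0 := by simpa using hj
      simp only [h₁ listA (by decide), hlist]
      rfl
  · rintro k - m' ⟨h, -⟩ -
    simp only [Expr.eval, h 0 (by decide), hd₁.input.size]
  · rintro k hk m₂ hv ⟨h₂, L, hL, hLm⟩
    have hL' : IsStateTable G c (⟨k, hk⟩ : Fin n).val L := hL
    have hle := hL.length_le hP hc (c ⟨k, hk⟩)
    have hcard : (L (c ⟨k, hk⟩)).length ≤ 2 ^ n := by
      rw [← List.toFinset_card_of_nodup (hL _).1]
      exact (Finset.card_le_univ _).trans (by simp)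
    refine (haltsIn_extendProg (hd₁.congr h₂ (by decide)) (v := ⟨k, hk⟩) hv hLm hcard ?_).mono ?_ ?_
    · intro X hX hmem
      exact lt_irrefl _ ((((hL' _).2 X).1 hX).2 _ hmem).2
    · gcongr
    · rintro m₃ ⟨hL₃, h₃⟩
      refine ⟨by rw [h₃ vR (by decide), hv],
        (h₂.trans (h₃.mono (by decide))).set (by decide) _ _, _, hL'.update hP hc,
        hL₃.congr (F := {vR}) ((AgreeOff.refl _ _).set (by decide) _ _) (by decide)⟩
  · rintro m₂ - ⟨h₂, hL⟩
    exact ⟨hL, (h₁.mono (by decide)).trans h₂⟩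

/-! ### The programs that merge two labels -/

/-- The labels that are not in `D` are marked in `deadA`. -/
def HasDead (D : Finset (Fin n)) (m : Memory) : Prop := ∀ a : Fin n, m deadA a.val = ind (a ∉ D)

theorem HasDead.congr {D : Finset (Fin n)} {m m' : Memory} {F : Finset ℕ} (h : HasDead D m)
    (h' : AgreeOff F m m') (hF : deadA ∉ F) : HasDead D m' := by
  intro a
  rw [h' deadA hF, h a]

/-- `acc :=` the number of adjacent pairs that consist of a vertex with label `a` and a vertex whose
label is remaining and different from `a` and `b`, where `a` and `b` are the labels in `vR` and
`uR`. -/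
def outsideProg : Program :=
  sumProg₂ accR xR yR
    (andE
      (andE (eqE (.cell labelA (reg xR)) (reg vR))
        (eqE (.cell deadA (.cell labelA (reg yR))) (.const 0)))
      (andE
        (andE (notE (eqE (.cell labelA (reg yR)) (reg vR)))
          (notE (eqE (.cell labelA (reg yR)) (reg uR))))
        (matE adjA (reg xR) (reg yR))))

theorem haltsIn_outsideProg {m : Memory} (hm : HasData G c m) {D : Finset (Fin n)}
    (hD : HasDead D m) {a b : Fin n} (ha : m vR 0 = a.val) (hb : m uR 0 = b.val) :
    HaltsIn (maxEntry n) outsideProg m (3 * n ^ 2 + 4 * n + 3) fun m' =>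
      (m' accR 0 = 0 ↔ ∀ u v, c u = a → c v ∈ D → c v ≠ a → c v ≠ b → ¬ G.Adj u v) ∧
      AgreeOff {xR, yR, accR} m m' := by
  refine (haltsIn_sumProg₂ (g := fun u v : Fin n =>
    ind ((c u = a ∧ c v ∈ D) ∧ (¬ c v = a ∧ ¬ c v = b) ∧ G.Adj u v)) (by decide)
    hm.input.size (le_maxEntry n) ?_ ?_).mono le_rfl fun m' h => ?_
  · intro u v m' h hu hv
    have hm' := hm.congr h (by decide)
    have hD' := hD.congr h (by decide)
    have ha' : m' vR 0 = a.val := by rw [h vR (by decide), ha]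
    have hb' : m' uR 0 = b.val := by rw [h uR (by decide), hb]
    have hdead : (ind (c v ∉ D) = 0) = (c v ∈ D) := by rw [ind_eq_zero, not_not]
    simp only [eval_andE, eval_eqE, eval_notE, Expr.eval, Op.eval, hu, hv, ha', hb',
      hm'.input.size, hm'.input.label, hm'.input.adj, hD' (c v), hdead, one_sub_ind, ind_mul,
      Fin.val_inj]
  · exact (sum_sum_ind_le _).trans (sq_lt_maxEntry n).le
  · refine ⟨?_, h.2⟩
    rw [h.1]
    simp only [Finset.sum_eq_zero_iff, Finset.mem_univ, true_imp_iff, ind_eq_zero]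
    refine forall_congr' fun u => forall_congr' fun v => ?_
    tauto

/-- Store labels `a` and `b` that satisfy `IsMergeable` in `fromR` and `intoR`, if there are any. -/
def findProg : Program :=
  forLoop vR (reg 0) <| forLoop uR (reg 0) <|
    .seq outsideProg <|
    .ite (andE
        (andE (eqE (reg accR) (.const 0)) (notE (eqE (reg vR) (reg uR))))
        (andE (eqE (.cell deadA (reg vR)) (.const 0)) (eqE (.cell deadA (reg uR)) (.const 0))))
      (.seq (setReg fromR (reg vR)) (setReg intoR (reg uR))) .skip

/-- The registers changed by `findProg`. -/
abbrev findFrame : Finset ℕ := {xR, yR, accR, vR, uR, fromR, intoR}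

theorem haltsIn_findProg {m : Memory} (hm : HasData G c m) {D : Finset (Fin n)}
    (hD : HasDead D m) (hex : ∃ a b, IsMergeable G c D a b) :
    HaltsIn (maxEntry n) findProg m (n * (n * (3 * n ^ 2 + 4 * n + 8) + 4) + 2) fun m' =>
      (∃ a b, IsMergeable G c D a b ∧ m' fromR 0 = a.val ∧ m' intoR 0 = b.val) ∧
      AgreeOff findFrame m m' := by
  have hn := le_maxEntry n
  -- a suitable pair is found, or there is none among the pairs tested so far
  let Found : Memory → Prop := fun m' =>
    ∃ a b, IsMergeable G c D a b ∧ m' fromR 0 = a.val ∧ m' intoR 0 = b.val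
  have hFound : ∀ m' m'' : Memory, AgreeOff {xR, yR, accR, vR, uR} m' m'' → Found m' → Found m'' :=
    fun m' m'' h ⟨a, b, hab, h1, h2⟩ =>
      ⟨a, b, hab, by rw [h fromR (by decide), h1], by rw [h intoR (by decide), h2]⟩
  refine HaltsIn.mono (T := n * ((n * ((3 * n ^ 2 + 4 * n + 6) + 2) + 2) + 2) + 2) ?_
    (le_of_eq (by ring)) fun _ h => h
  refine HaltsIn.forLoop (N := n) (fun k m' =>
    AgreeOff findFrame m m' ∧ (Found m' ∨ ∀ a b, a.val < k → ¬ IsMergeable G c D a b))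
    hn ?_ ?_ ?_ ?_
  · exact ⟨(AgreeOff.refl _ _).set (by decide) _ _, Or.inr fun a b h => by omega⟩
  · rintro k - m' ⟨h, -⟩ -
    simp only [Expr.eval, h 0 (by decide), hm.input.size]
  · rintro k hk m₁ hv ⟨h₁, hf₁⟩
    refine HaltsIn.forLoop (N := n) (fun l m' => m' vR 0 = k ∧ AgreeOff findFrame m m' ∧
      (Found m' ∨ (∀ a b, a.val < k → ¬ IsMergeable G c D a b) ∧
        ∀ b, b.val < l → ¬ IsMergeable G c D ⟨k, hk⟩ b)) hn ?_ ?_ ?_ ?_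
    · refine ⟨by rw [Memory.set_of_ne _ (by decide), hv], h₁.set (by decide) _ _, ?_⟩
      refine hf₁.imp (hFound _ _ ((AgreeOff.refl _ _).set (by decide) _ _)) fun h =>
        ⟨h, fun b hb => by omega⟩
    · rintro l - m' ⟨-, h, -⟩ -
      simp only [Expr.eval, h 0 (by decide), hm.input.size]
    · rintro l hl m₂ hu ⟨hv₂, h₂, hf₂⟩
      refine HaltsIn.mono (T := (3 * n ^ 2 + 4 * n + 3) + (2 + 1)) (HaltsIn.seq
        ((haltsIn_outsideProg (hm.congr h₂ (by decide)) (hD.congr h₂ (by decide))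
          (a := ⟨k, hk⟩) (b := ⟨l, hl⟩) hv₂ hu).mono le_rfl ?_)) (by omega) fun _ h => h
      rintro m₃ ⟨hacc, h₃⟩
      have hv₃ : m₃ vR 0 = k := by rw [h₃ vR (by decide), hv₂]
      have hu₃ : m₃ uR 0 = l := by rw [h₃ uR (by decide), hu]
      have hD₃ : HasDead D m₃ := (hD.congr h₂ (by decide)).congr h₃ (by decide)
      have hDk := hD₃ ⟨k, hk⟩
      have hDl := hD₃ ⟨l, hl⟩
      simp only at hDk hDl
      have htest : ∀ e : ℕ, e = (andE
          (andE (eqE (reg accR) (.const 0)) (notE (eqE (reg vR) (reg uR))))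
          (andE (eqE (.cell deadA (reg vR)) (.const 0))
            (eqE (.cell deadA (reg uR)) (.const 0)))).eval m₃ →
          (e = 0 ↔ ¬ IsMergeable G c D ⟨k, hk⟩ ⟨l, hl⟩) := by
        rintro e rfl
        simp only [eval_andE, eval_eqE, eval_notE, Expr.eval, hv₃, hu₃, hDk, hDl, ind_eq_zero,
          one_sub_ind, ind_mul, not_not, hacc, IsMergeable, ne_eq, Fin.mk.injEq]
        tauto
      refine HaltsIn.ite (fun h => ?_) fun h => ?_
      · have hab : IsMergeable G c D ⟨k, hk⟩ ⟨l, hl⟩ := by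
          by_contra hn
          exact h ((htest _ rfl).2 hn)
        refine HaltsIn.seq (T₁ := 1) (T₂ := 1) (HaltsIn.write ?_ (HaltsIn.write ?_ ?_))
        · simp only [Expr.eval, hv₃]
          omega
        · simp only [Expr.eval, Memory.set_of_ne _ (show uR ≠ fromR by decide), hu₃]
          omega
        · simp only [Expr.eval, Memory.set_of_ne _ (show uR ≠ fromR by decide), hv₃, hu₃]
          refine ⟨?_, ?_, ?_, Or.inl ⟨_, _, hab, ?_, ?_⟩⟩
          · simp only [Memory.set_of_ne _ (show uR ≠ intoR by decide),
              Memory.set_of_ne _ (show uR ≠ fromR by decide), hu₃]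
          · simp only [Memory.set_of_ne _ (show vR ≠ uR by decide),
              Memory.set_of_ne _ (show vR ≠ intoR by decide),
              Memory.set_of_ne _ (show vR ≠ fromR by decide), hv₃]
          · exact (((h₂.trans (h₃.mono (by decide))).set (by decide) _ _).set (by decide) _ _).set
              (by decide) _ _
          · simp only [Memory.set_of_ne _ (show fromR ≠ uR by decide),
              Memory.set_of_ne _ (show fromR ≠ intoR by decide), Memory.set_self]
          · simp only [Memory.set_of_ne _ (show intoR ≠ uR by decide), Memory.set_self]
      · have hab := (htest _ rfl).1 h
        refine (HaltsIn.skip ?_).mono one_le_two fun _ h => h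
        refine ⟨hu₃, ?_, ?_, ?_⟩
        · rw [Memory.set_of_ne _ (by decide), hv₃]
        · exact (h₂.trans (h₃.mono (by decide))).set (by decide) _ _
        · refine hf₂.imp (hFound _ _ ((h₃.mono (by decide)).set (by decide) _ _)) fun h =>
            ⟨h.1, fun b hb => ?_⟩
          rcases Nat.lt_succ_iff_lt_or_eq.1 hb with hb | hb
          · exact h.2 b hb
          · rwa [show b = ⟨l, hl⟩ from Fin.ext hb]
    · rintro m₂ hu ⟨hv₂, h₂, hf₂⟩
      refine ⟨hv₂, h₂.set (by decide) _ _, ?_⟩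
      refine hf₂.imp (hFound _ _ ((AgreeOff.refl _ _).set (by decide) _ _)) fun h a b ha => ?_
      rcases Nat.lt_succ_iff_lt_or_eq.1 ha with ha | ha
      · exact h.1 a b ha
      · rw [show a = ⟨k, hk⟩ from Fin.ext ha]
        exact h.2 b b.2
  · rintro m' - ⟨h, hf⟩
    refine ⟨hf.resolve_right fun hno => ?_, h⟩
    obtain ⟨a, b, hab⟩ := hex
    exact hno a b a.2 hab

/-- `bestSet := X ∪ Z` with the largest cut size, where `X` is the set in `baseR` and `Z` ranges
over the list for the label in `fromR`. The unions are disjoint, so that codes are added. -/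
def argmaxProg : Program :=
  .seq (setReg bestR (.const 0)) <|
  forLoop jR (.cell lenA (reg fromR)) <|
    .seq (setReg setR (.op .add (reg baseR) (matE listA (reg jR) (reg fromR)))) <|
    .seq cutProg <|
    .ite (ltE (reg bestR) (.op .add (reg accR) (.const 1)))
      (.seq (setReg bestR (reg accR)) (setReg bestSetR (reg setR))) .skip

/-- The registers changed by `argmaxProg`. -/
abbrev argmaxFrame : Finset ℕ := {xR, yR, accR, setR, jR, bestR, bestSetR}

theorem haltsIn_argmaxProg {m : Memory} (hm : HasData G c m) {L : Fin n → List (Finset (Fin n))}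
    (hL : HasTable L m) {a : Fin n} (ha : m fromR 0 = a.val) {X : Finset (Fin n)}
    (hX : m baseR 0 = encode X) (hdisj : ∀ Z ∈ L a, Disjoint X Z) (hne : L a ≠ [])
    (hlen : (L a).length ≤ 2 ^ n) :
    HaltsIn (maxEntry n) argmaxProg m ((L a).length * (3 * n ^ 2 + 4 * n + 9) + 3) fun m' =>
      (∃ Z ∈ L a, m' bestSetR 0 = encode (X ∪ Z) ∧
        ∀ Z' ∈ L a, cutValue G (X ∪ Z') ≤ cutValue G (X ∪ Z)) ∧ AgreeOff argmaxFrame m m' := by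
  have hpow := two_pow_le_maxEntry n
  rw [pow_succ] at hpow
  refine HaltsIn.mono (T := 1 + ((L a).length * ((3 * n ^ 2 + 4 * n + 7) + 2) + 2)) ?_
    (le_of_eq (by ring)) fun _ h => h
  refine HaltsIn.seq (HaltsIn.write (by simp [Expr.eval]) ?_)
  simp only [Expr.eval]
  refine HaltsIn.forLoop (N := (L a).length) (fun k m' => AgreeOff argmaxFrame m m' ∧
    (k = 0 ∧ m' bestR 0 = 0 ∨ ∃ Z ∈ L a, m' bestSetR 0 = encode (X ∪ Z) ∧
      m' bestR 0 = cutValue G (X ∪ Z) ∧ ∀ (j : ℕ) (hj : j < (L a).length), j < k →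
        cutValue G (X ∪ (L a)[j]) ≤ cutValue G (X ∪ Z))) (by omega) ?_ ?_ ?_ ?_
  · refine ⟨((AgreeOff.refl _ _).set (by decide) _ _).set (by decide) _ _, Or.inl ⟨rfl, ?_⟩⟩
    rw [Memory.set_of_ne _ (by decide), Memory.set_self]
  · rintro k - m' ⟨h, -⟩ -
    simp only [Expr.eval, h fromR (by decide), ha, ((hL.congr h (by decide)) a).1]
  · rintro k hk m₁ hj ⟨h₁, hbest⟩
    have hd₁ := hm.congr h₁ (by decide)
    have e₁ : (Expr.op .add (reg baseR) (matE listA (reg jR) (reg fromR))).eval m₁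
        = encode (X ∪ (L a)[k]) := by
      rw [encode_union (hdisj _ (List.getElem_mem hk))]
      have h2 : m₁ listA (k * n + a.val) = encode (L a)[k] :=
        ((hL.congr h₁ (by decide)) a).2 k hk
      simp only [Expr.eval, Op.eval, hj, h₁ fromR (by decide), ha, h₁ baseR (by decide), hX,
        hd₁.input.size, h2]
    refine HaltsIn.mono (T := 1 + ((3 * n ^ 2 + 4 * n + 3) + (2 + 1))) ?_ (by omega) fun _ h => h
    refine HaltsIn.seq (HaltsIn.write ?_ (HaltsIn.seq ?_))
    · rw [e₁]
      exact (encode_lt_two_pow _).le.trans (by omega)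
    rw [e₁]
    have h₂ : AgreeOff {setR} m₁ (m₁.set setR 0 (encode (X ∪ (L a)[k]))) :=
      (AgreeOff.refl _ _).set (by decide) _ _
    refine (haltsIn_cutProg (hd₁.congr h₂ (by decide)) (Memory.set_self _ _ _ _)).mono le_rfl ?_
    rintro m₃ ⟨hacc, h₃⟩
    have h₃' : AgreeOff {xR, yR, accR, setR} m₁ m₃ :=
      (h₂.mono (by decide)).trans (h₃.mono (by decide))
    have hset₃ : m₃ setR 0 = encode (X ∪ (L a)[k]) := by
      rw [h₃ setR (by decide), Memory.set_self]
    have hj₃ : m₃ jR 0 = k := by rw [h₃' jR (by decide), hj]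
    have hF := h₁.trans (h₃'.mono (show _ ⊆ argmaxFrame by decide))
    have hbest₃ := hbest
    rw [← h₃' bestSetR (by decide), ← h₃' bestR (by decide)] at hbest₃
    refine HaltsIn.ite (fun h => ?_) fun h => ?_
    · rw [eval_ltE, ne_eq, ind_eq_zero, not_not] at h
      simp only [Expr.eval, Op.eval, hacc] at h
      refine HaltsIn.seq (T₁ := 1) (T₂ := 1) (HaltsIn.write ?_ (HaltsIn.write ?_ ?_))
      · simp only [Expr.eval, hacc]
        exact (cutValue_lt_maxEntry _).le
      · simp only [Expr.eval, Memory.set_of_ne _ (show setR ≠ bestR by decide), hset₃]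
        exact (encode_lt_two_pow _).le.trans (by omega)
      · simp only [Expr.eval, Memory.set_of_ne _ (show setR ≠ bestR by decide), hset₃, hacc]
        refine ⟨?_, ?_, Or.inr ⟨(L a)[k], List.getElem_mem hk, ?_, ?_, fun j hj' hjk => ?_⟩⟩
        · rw [Memory.set_of_ne _ (by decide), Memory.set_of_ne _ (by decide), hj₃]
        · exact ((hF.set (by decide) _ _).set (by decide) _ _).set (by decide) _ _
        · rw [Memory.set_of_ne _ (by decide), Memory.set_self]
        · rw [Memory.set_of_ne _ (by decide), Memory.set_of_ne _ (by decide), Memory.set_self]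
        · rcases Nat.lt_succ_iff_lt_or_eq.1 hjk with hjk | rfl
          · rcases hbest₃ with ⟨rfl, -⟩ | ⟨Z, -, -, hZ, hle⟩
            · omega
            · have := hle j hj' hjk
              omega
          · exact le_rfl
    · rw [eval_ltE, ind_eq_zero] at h
      simp only [Expr.eval, Op.eval, hacc] at h
      refine (HaltsIn.skip ⟨hj₃, hF.set (by decide) _ _, Or.inr ?_⟩).mono one_le_two fun _ h => h
      rcases hbest₃ with ⟨-, h0⟩ | ⟨Z, hZ, hcode, hcut, hle⟩
      · omega
      · refine ⟨Z, hZ, ?_, ?_, fun j hj' hjk => ?_⟩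
        · rw [Memory.set_of_ne _ (by decide), hcode]
        · rw [Memory.set_of_ne _ (by decide), hcut]
        · rcases Nat.lt_succ_iff_lt_or_eq.1 hjk with hjk | rfl
          · exact hle j hj' hjk
          · omega
  · rintro m' - ⟨h, hbest⟩
    refine ⟨?_, h⟩
    rcases hbest with ⟨h0, -⟩ | ⟨Z, hZ, hcode, -, hle⟩
    · exact absurd (List.length_eq_zero_iff.1 h0) hne
    · refine ⟨Z, hZ, hcode, fun Z' hZ' => ?_⟩
      obtain ⟨j, hj, rfl⟩ := List.getElem_of_mem hZ'
      exact hle j hj hj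

/-- Join every set in the list for the label in `intoR` with a best possible set in the list for
the label in `fromR`, and mark the latter label. -/
def mergeProg : Program :=
  .seq (forLoop iR (.cell lenA (reg intoR)) <|
    .seq (setReg baseR (matE listA (reg iR) (reg intoR))) <|
    .seq argmaxProg
    (.write listA (.op .add (.op .mul (reg iR) (reg 0)) (reg intoR)) (reg bestSetR)))
  (.write deadA (reg fromR) (.const 1))

theorem HasTable.set {L : Fin n → List (Finset (Fin n))} {m : Memory} (h : HasTable L m)
    (b : Fin n) {k : ℕ} (W : Finset (Fin n)) :
    HasTable (Function.update L b ((L b).set k W)) (m.set listA (k * n + b.val) (encode W)) := by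
  intro a
  rw [Memory.set_of_ne _ (show lenA ≠ listA by decide)]
  by_cases hab : a = b
  · subst hab
    rw [Function.update_self, List.length_set]
    refine ⟨(h a).1, fun j hj => ?_⟩
    rw [List.length_set] at hj
    beta_reduce
    rw [List.getElem_set, Memory.set]
    by_cases hjk : k = j
    · simp [hjk]
    · rw [if_neg hjk, if_neg fun e => hjk (mul_add_inj e.2).1.symm]
      exact (h a).2 j hj
  · rw [Function.update_of_ne hab]
    refine ⟨(h a).1, fun j hj => ?_⟩
    beta_reduce
    rw [Memory.set, if_neg fun e => hab (mul_add_inj e.2).2]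
    exact (h a).2 j hj

/-- The arrays changed by `mergeProg`. -/
abbrev mergeFrame : Finset ℕ :=
  {xR, yR, accR, setR, jR, bestR, bestSetR, baseR, iR, listA, deadA}

theorem haltsIn_mergeProg {m : Memory} (hm : HasData G c m) {D : Finset (Fin n)}
    (hD : HasDead D m) {L : Fin n → List (Finset (Fin n))} (hL : HasTable L m) {a b : Fin n}
    (hab : a ≠ b) (ha : m fromR 0 = a.val) (hb : m intoR 0 = b.val)
    (hdisj : ∀ X ∈ L b, ∀ Z ∈ L a, Disjoint X Z) (hne : L a ≠ []) {N : ℕ}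
    (hlen : ∀ d, (L d).length ≤ N ∧ (L d).length ≤ 2 ^ n) :
    HaltsIn (maxEntry n) mergeProg m (N * (N * (3 * n ^ 2 + 4 * n + 9) + 7) + 3) fun m' =>
      (∃ l', l'.length = (L b).length ∧ IsMerge G (L a) (L b) l' ∧
        HasTable (Function.update L b l') m') ∧ HasDead (D.erase a) m' ∧
      AgreeOff mergeFrame m m' := by
  have hpow := two_pow_le_maxEntry n
  rw [pow_succ] at hpow
  have hlb := (hlen b).2
  refine HaltsIn.mono (T := ((L b).length *
    ((1 + (((L a).length * (3 * n ^ 2 + 4 * n + 9) + 3) + 1)) + 2) + 2) + 1) ?_ ?_ fun _ h => h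
  swap
  · calc ((L b).length * ((1 + (((L a).length * (3 * n ^ 2 + 4 * n + 9) + 3) + 1)) + 2) + 2) + 1
        = (L b).length * ((L a).length * (3 * n ^ 2 + 4 * n + 9) + 7) + 3 := by ring
      _ ≤ N * (N * (3 * n ^ 2 + 4 * n + 9) + 7) + 3 := by
        have h1 := (hlen a).1
        have h2 := (hlen b).1
        gcongr
  let F : Finset ℕ := {xR, yR, accR, setR, jR, bestR, bestSetR, baseR, iR, listA}
  refine HaltsIn.seq (HaltsIn.forLoop (N := (L b).length) (fun k m' => AgreeOff F m m' ∧
    ∃ l' : List (Finset (Fin n)), HasTable (Function.update L b l') m' ∧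
      ∃ hl : l'.length = (L b).length, ∀ (j : ℕ) (hj : j < (L b).length),
        (k ≤ j → l'[j] = (L b)[j]) ∧ (j < k → (∃ Z ∈ L a, l'[j] = (L b)[j] ∪ Z) ∧
          ∀ Z ∈ L a, cutValue G ((L b)[j] ∪ Z) ≤ cutValue G l'[j])) (by omega) ?_ ?_ ?_ ?_)
  · refine ⟨(AgreeOff.refl _ _).set (by decide) _ _, L b, ?_, rfl, fun j hj =>
      ⟨fun _ => rfl, fun h => absurd h (Nat.not_lt_zero _)⟩⟩
    rw [Function.update_eq_self]
    exact hL.congr (F := {iR}) ((AgreeOff.refl _ _).set (by decide) _ _) (by decide)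
  · rintro k - m' ⟨h, l', hL', hl, -⟩ -
    have := (hL' b).1
    rw [Function.update_self, hl] at this
    simp only [Expr.eval, h intoR (by decide), hb, this]
  · rintro k hk m₁ hi ⟨h₁, l', hL₁, hl, hspec⟩
    have hd₁ := hm.congr h₁ (by decide)
    have hka := hspec k hk
    have e₁ : (matE listA (reg iR) (reg intoR)).eval m₁ = encode (L b)[k] := by
      have h2 := (hL₁ b).2
      rw [Function.update_self] at h2
      have h3 : m₁ listA (k * n + b.val) = encode l'[k] := h2 k (by omega)
      rw [hka.1 le_rfl] at h3
      simp only [Expr.eval, Op.eval, hi, h₁ intoR (by decide), hb, hd₁.input.size, h3]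
    refine HaltsIn.seq (HaltsIn.write ?_ (HaltsIn.seq ?_))
    · rw [e₁]
      exact (encode_lt_two_pow _).le.trans (by omega)
    rw [e₁]
    have h₂ : AgreeOff {baseR} m₁ (m₁.set baseR 0 (encode (L b)[k])) :=
      (AgreeOff.refl _ _).set (by decide) _ _
    have hLa : Function.update L b l' a = L a := Function.update_of_ne hab _ _
    have hkm : (L b)[k] ∈ L b := List.getElem_mem hk
    have hargmax := haltsIn_argmaxProg (hd₁.congr h₂ (by decide)) (hL₁.congr h₂ (by decide))
      (a := a) (by rw [Memory.set_of_ne _ (by decide), h₁ fromR (by decide), ha])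
      (X := (L b)[k]) (Memory.set_self _ _ _ _) (by rw [hLa]; exact hdisj _ hkm)
      (by rwa [hLa]) (by rw [hLa]; exact (hlen a).2)
    rw [hLa] at hargmax
    refine hargmax.mono le_rfl ?_
    rintro m₃ ⟨⟨Z, hZ, hcode, hZmax⟩, h₃⟩
    have h₃' : AgreeOff {xR, yR, accR, setR, jR, bestR, bestSetR, baseR} m₁ m₃ :=
      (h₂.mono (by decide)).trans (h₃.mono (by decide))
    have hd₃ := hd₁.congr h₃' (by decide)
    have hi₃ : m₃ iR 0 = k := by rw [h₃' iR (by decide), hi]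
    have hb₃ : m₃ intoR 0 = b.val := by rw [h₃' intoR (by decide), h₁ intoR (by decide), hb]
    have e₃ : (Expr.op .add (.op .mul (reg iR) (reg 0)) (reg intoR)).eval m₃
        = k * n + b.val := by
      simp only [Expr.eval, Op.eval, hi₃, hb₃, hd₃.input.size]
    have e₃' : (reg bestSetR).eval m₃ = encode ((L b)[k] ∪ Z) := by
      simp only [Expr.eval, hcode]
    refine HaltsIn.write ?_ ?_
    · rw [e₃']
      exact (encode_lt_two_pow _).le.trans (by omega)
    rw [e₃, e₃']
    refine ⟨by rw [Memory.set_of_ne _ (by decide), hi₃], ?_, l'.set k ((L b)[k] ∪ Z), ?_, ?_,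
      fun j hj => ?_⟩
    · exact ((h₁.trans (h₃'.mono (by decide))).set (by decide) _ _).set (by decide) _ _
    · have h4 := (hL₁.congr h₃' (by decide)).set b (k := k) ((L b)[k] ∪ Z)
      rw [Function.update_self, Function.update_idem] at h4
      exact h4.congr (F := {iR}) ((AgreeOff.refl _ _).set (by decide) _ _) (by decide)
    · rw [List.length_set, hl]
    · rw [List.getElem_set]
      split_ifs with hkj
      · subst hkj
        exact ⟨fun h => absurd h (by omega), fun _ => ⟨⟨Z, hZ, rfl⟩, hZmax⟩⟩
      · exact ⟨fun h => (hspec j hj).1 (by omega), fun h => (hspec j hj).2 (by omega)⟩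
  rintro m₁ - ⟨h₁, l', hL₁, hl, hspec⟩
  have ha₁ : m₁ fromR 0 = a.val := by rw [h₁ fromR (by decide), ha]
  refine HaltsIn.write (by simp only [Expr.eval]; exact Nat.one_le_two_pow) ?_
  simp only [Expr.eval, ha₁]
  refine ⟨⟨l', hl, ⟨fun W hW => ?_, fun X hX => ?_⟩, ?_⟩, fun d => ?_, ?_⟩
  · obtain ⟨j, hj, rfl⟩ := List.getElem_of_mem hW
    obtain ⟨⟨Z, hZ, he⟩, -⟩ := (hspec j (by omega)).2 (by omega)
    exact ⟨_, List.getElem_mem (by omega), Z, hZ, he⟩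
  · obtain ⟨j, hj, rfl⟩ := List.getElem_of_mem hX
    exact ⟨l'[j], List.getElem_mem _, (hspec j hj).2 hj⟩
  · exact hL₁.congr (F := {deadA}) ((AgreeOff.refl _ _).set (by decide) _ _) (by decide)
  · have := hD.congr h₁ (by decide) d
    rw [Memory.set]
    by_cases hda : d = a
    · simp [hda, ind]
    · rw [if_neg fun e => hda (Fin.ext e.2), this]
      simp only [Finset.mem_erase, ne_eq, hda, not_false_eq_true, true_and]
  · exact (h₁.mono (by decide)).set (by decide) _ _

/-! ### The whole program -/

/-- Fill the array of the powers of two. -/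
def powersProg : Program :=
  .seq (.write powA (.const 0) (.const 1)) <|
  forLoop vR (reg 0) (.write powA (.op .add (reg vR) (.const 1))
    (.op .add (.cell powA (reg vR)) (.cell powA (reg vR))))

theorem haltsIn_powersProg {m : Memory} (hm : HasInput G c m) :
    HaltsIn (maxEntry n) powersProg m (3 * n + 3) fun m' =>
      HasPowers n m' ∧ AgreeOff {powA, vR} m m' := by
  have hpow := two_pow_le_maxEntry n
  refine HaltsIn.mono (T := 1 + (n * (1 + 2) + 2)) ?_ (by omega) fun _ h => h
  refine HaltsIn.seq (HaltsIn.write (by simp only [Expr.eval]; exact Nat.one_le_two_pow) ?_)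
  simp only [Expr.eval]
  refine HaltsIn.forLoop (N := n) (fun k m' => AgreeOff {powA, vR} m m' ∧
    ∀ j ≤ k, m' powA j = 2 ^ j) (le_maxEntry n) ?_ ?_ ?_ ?_
  · refine ⟨((AgreeOff.refl _ _).set (by decide) _ _).set (by decide) _ _, fun j hj => ?_⟩
    obtain rfl : j = 0 := by omega
    rw [Memory.set_of_ne _ (by decide), Memory.set_self, pow_zero]
  · rintro k - m' ⟨h, -⟩ -
    simp only [Expr.eval, h 0 (by decide), hm.size]
  · rintro k hk m₁ hv ⟨h₁, hp⟩
    have e : (Expr.op .add (.cell powA (reg vR)) (.cell powA (reg vR))).eval m₁ = 2 ^ (k + 1) := by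
      simp only [Expr.eval, Op.eval, hv, hp k le_rfl]
      ring
    refine HaltsIn.write ?_ ?_
    · rw [e]
      exact (Nat.pow_le_pow_right (by norm_num) (by omega)).trans hpow
    rw [e]
    simp only [Expr.eval, Op.eval, hv]
    refine ⟨by rw [Memory.set_of_ne _ (by decide), hv],
      (h₁.set (by decide) _ _).set (by decide) _ _, fun j hj => ?_⟩
    rw [Memory.set_of_ne _ (by decide), Memory.set]
    split_ifs with hjk
    · rw [hjk.2]
    · exact hp j (by omega)
  · rintro m' - ⟨h, hp⟩
    exact ⟨fun u => hp u.val u.2.le, h⟩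

/-- Fill the matrix of the twin relation. -/
def twinsProg : Program :=
  forLoop vR (reg 0) <| forLoop uR (reg 0) <|
    .seq (sumProg₁ accR xR
      (andE (andE (notE (eqE (reg xR) (reg vR))) (notE (eqE (reg xR) (reg uR))))
        (notE (eqE (matE adjA (reg vR) (reg xR)) (matE adjA (reg uR) (reg xR))))))
    (.write twinA (.op .add (.op .mul (reg vR) (reg 0)) (reg uR))
      (andE (matE adjA (reg vR) (reg uR)) (eqE (reg accR) (.const 0))))

theorem ind_inj {p q : Prop} : ind p = ind q ↔ (p ↔ q) := by
  by_cases hp : p <;> by_cases hq : q <;> simp [ind, hp, hq]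

theorem haltsIn_twinsProg {m : Memory} (hm : HasInput G c m) :
    HaltsIn (maxEntry n) twinsProg m (n * (n * (3 * n + 6) + 4) + 2) fun m' =>
      HasTwins G m' ∧ AgreeOff {accR, xR, vR, uR, twinA} m m' := by
  have hn := le_maxEntry n
  let F : Finset ℕ := {accR, xR, vR, uR, twinA}
  refine HaltsIn.mono (T := n * ((n * (((3 * n + 3) + 1) + 2) + 2) + 2) + 2) ?_
    (le_of_eq (by ring)) fun _ h => h
  refine HaltsIn.forLoop (N := n) (fun k m' => AgreeOff F m m' ∧
    ∀ u v : Fin n, u.val < k → m' twinA (u.val * n + v.val) = ind (AreTwins G u v)) hn ?_ ?_ ?_ ?_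
  · exact ⟨(AgreeOff.refl _ _).set (by decide) _ _, fun u v h => absurd h (Nat.not_lt_zero _)⟩
  · rintro k - m' ⟨h, -⟩ -
    simp only [Expr.eval, h 0 (by decide), hm.size]
  · rintro k hk m₁ hv ⟨h₁, ht₁⟩
    refine HaltsIn.forLoop (N := n) (fun l m' => m' vR 0 = k ∧ AgreeOff F m m' ∧
      ∀ u v : Fin n, u.val < k ∨ u.val = k ∧ v.val < l →
        m' twinA (u.val * n + v.val) = ind (AreTwins G u v)) hn ?_ ?_ ?_ ?_
    · refine ⟨by rw [Memory.set_of_ne _ (by decide), hv], h₁.set (by decide) _ _, fun u v h => ?_⟩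
      rw [Memory.set_of_ne _ (by decide)]
      exact ht₁ u v (by omega)
    · rintro l - m' ⟨-, h, -⟩ -
      simp only [Expr.eval, h 0 (by decide), hm.size]
    · rintro l hl m₂ hu ⟨hv₂, h₂, ht₂⟩
      have hm₂ : HasInput G c m₂ := hm.congr h₂ (by decide)
      refine HaltsIn.seq (T₁ := 3 * n + 3) (T₂ := 1) ((haltsIn_sumProg₁ (g := fun q : Fin n =>
        ind ((¬ q.val = k ∧ ¬ q.val = l) ∧ ¬ (G.Adj ⟨k, hk⟩ q ↔ G.Adj ⟨l, hl⟩ q))) (by decide)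
        hm₂.size hn ?_ ?_).mono le_rfl ?_)
      · intro q m' h hq
        have hm' : HasInput G c m' := hm₂.congr h (by decide)
        have hk' : m' adjA (k * n + q.val) = ind (G.Adj ⟨k, hk⟩ q) := hm'.adj ⟨k, hk⟩ q
        have hl' : m' adjA (l * n + q.val) = ind (G.Adj ⟨l, hl⟩ q) := hm'.adj ⟨l, hl⟩ q
        simp only [eval_andE, eval_eqE, eval_notE, Expr.eval, Op.eval, hq, h vR (by decide), hv₂,
          h uR (by decide), hu, hm'.size, hk', hl', ind_inj, one_sub_ind, ind_mul]
      · calc ∑ q : Fin n, ind _ ≤ ∑ _q : Fin n, 1 := Finset.sum_le_sum fun _ _ => ind_le_one _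
          _ ≤ maxEntry n := by simpa using hn
      · rintro m₃ ⟨hacc, h₃⟩
        have hm₃ : HasInput G c m₃ := hm₂.congr h₃ (by decide)
        have hv₃ : m₃ vR 0 = k := by rw [h₃ vR (by decide), hv₂]
        have hu₃ : m₃ uR 0 = l := by rw [h₃ uR (by decide), hu]
        have e₁ : (Expr.op .add (.op .mul (reg vR) (reg 0)) (reg uR)).eval m₃ = k * n + l := by
          simp only [Expr.eval, Op.eval, hv₃, hu₃, hm₃.size]
        have e₂ : (andE (matE adjA (reg vR) (reg uR)) (eqE (reg accR) (.const 0))).eval m₃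
            = ind (AreTwins G ⟨k, hk⟩ ⟨l, hl⟩) := by
          have h4 : m₃ adjA (k * n + l) = ind (G.Adj ⟨k, hk⟩ ⟨l, hl⟩) := hm₃.adj ⟨k, hk⟩ ⟨l, hl⟩
          simp only [eval_andE, eval_eqE, Expr.eval, Op.eval, hv₃, hu₃, hm₃.size, h4, ind_mul,
            ind_inj, hacc, areTwins_iff, Finset.sum_eq_zero_iff, ind_eq_zero, Finset.mem_univ,
            true_imp_iff, ne_eq, Fin.ext_iff]
          refine and_congr_right fun _ => forall_congr' fun q => ?_
          tauto
        refine HaltsIn.write ?_ ?_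
        · rw [e₂]
          exact (ind_le_one _).trans Nat.one_le_two_pow
        rw [e₁, e₂]
        refine ⟨by rw [Memory.set_of_ne _ (by decide), hu₃], ?_, ?_, fun u v huv => ?_⟩
        · rw [Memory.set_of_ne _ (by decide), Memory.set_of_ne _ (by decide), hv₃]
        · exact ((h₂.trans (h₃.mono (by decide))).set (by decide) _ _).set (by decide) _ _
        · rw [Memory.set_of_ne _ (by decide), Memory.set]
          split_ifs with he
          · have h5 : u.val * n + v.val = k * n + (⟨l, hl⟩ : Fin n).val := he.2
            obtain ⟨h6, rfl⟩ := mul_add_inj h5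
            rw [show u = ⟨k, hk⟩ from Fin.ext h6]
          · rw [h₃ twinA (by decide)]
            refine ht₂ u v (huv.imp_right fun h => ⟨h.1, ?_⟩)
            have : v.val ≠ l := by
              rintro rfl
              exact he ⟨rfl, by rw [h.1]⟩
            omega
    · rintro m₂ - ⟨hv₂, h₂, ht₂⟩
      refine ⟨hv₂, h₂.set (by decide) _ _, fun u v huk => ?_⟩
      rw [Memory.set_of_ne _ (by decide)]
      exact ht₂ u v (by omega)
  · rintro m' - ⟨h, ht⟩
    exact ⟨fun u v => ht u v u.2, h⟩

/-- Merge labels until a single one is left. -/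
def roundsProg : Program :=
  forLoop roundR (.op .sub (reg 0) (.const 1)) (.seq findProg mergeProg)

/-- A bound for the number of elementary steps of `roundsProg`, if the lists have length at most
`N`. -/
abbrev roundsCost (n N : ℕ) : ℕ :=
  n * (n * (n * (3 * n ^ 2 + 4 * n + 8) + 4) + N * (N * (3 * n ^ 2 + 4 * n + 9) + 7) + 7) + 2

theorem IsPartialSolution.ne_nil {D : Finset (Fin n)} {U : Fin n → Finset (Fin n)}
    {L : Fin n → List (Finset (Fin n))} (h : IsPartialSolution G c D U L) {a : Fin n}
    (ha : a ∈ D) : L a ≠ [] := by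
  obtain ⟨Y, hY, -⟩ := exists_isCanonical_forall_cutValue_le G
  obtain ⟨X, hX, -⟩ := h.exists_best a ha Y hY
  exact List.ne_nil_of_mem hX

theorem haltsIn_roundsProg (hP : IsBubblePartition G P) (hc : IsLabelling P c) {m : Memory}
    (hm : HasData G c m) (hn : 0 < n) (hD : HasDead (Finset.univ : Finset (Fin n)) m)
    {L : Fin n → List (Finset (Fin n))} (hL : IsStateTable G c n L) (hLm : HasTable L m)
    (hinto : m intoR 0 = 0) :
    HaltsIn (maxEntry n) roundsProg m (roundsCost n (stateBound G P)) fun m' =>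
      (∃ r U L', IsPartialSolution G c {r} U L' ∧ HasTable L' m' ∧ m' intoR 0 = r.val ∧
        (L' r).length ≤ stateBound G P ∧ (L' r).length ≤ 2 ^ n) ∧
      AgreeOff (insert roundR (findFrame ∪ mergeFrame)) m m' := by
  set N := stateBound G P with hN
  have hn' := le_maxEntry n
  have hle : (n - 1) * (((n * (n * (3 * n ^ 2 + 4 * n + 8) + 4) + 2) +
      (N * (N * (3 * n ^ 2 + 4 * n + 9) + 7) + 3)) + 2) + 2 ≤ roundsCost n N := by
    calc _ ≤ n * (((n * (n * (3 * n ^ 2 + 4 * n + 8) + 4) + 2) +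
          (N * (N * (3 * n ^ 2 + 4 * n + 9) + 7) + 3)) + 2) + 2 := by
          gcongr
          omega
      _ = roundsCost n N := by unfold roundsCost; ring
  refine HaltsIn.mono (HaltsIn.forLoop (N := n - 1) (fun k m' =>
    AgreeOff (insert roundR (findFrame ∪ mergeFrame)) m m' ∧
      ∃ D U L', D.card = n - k ∧ HasDead D m' ∧ IsPartialSolution G c D U L' ∧ HasTable L' m' ∧
        (∃ r ∈ D, m' intoR 0 = r.val) ∧ ∀ a, (L' a).length ≤ N ∧ (L' a).length ≤ 2 ^ n)
    (by omega) ?_ ?_ ?_ ?_) hle fun _ h => h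
  · have h₁ : AgreeOff {roundR} m (m.set roundR 0 0) := (AgreeOff.refl _ _).set (by decide) _ _
    refine ⟨h₁.mono (by decide), Finset.univ, _, L, by simp, hD.congr h₁ (by decide),
      hL.isPartialSolution hP hc, hLm.congr h₁ (by decide), ⟨⟨0, hn⟩, Finset.mem_univ _, ?_⟩,
      fun a => ⟨hL.length_le hP hc a, ?_⟩⟩
    · rw [h₁ intoR (by decide), hinto]
    · rw [← List.toFinset_card_of_nodup (hL a).1]
      exact (Finset.card_le_univ _).trans (by simp)
  · rintro k - m' ⟨h, -⟩ -
    simp only [Expr.eval, Op.eval, h 0 (by decide), hm.input.size]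
  · rintro k hk m₁ hr ⟨h₁, D, U, L₁, hcard, hD₁, hS, hL₁, -, hlen⟩
    have hd₁ := hm.congr h₁ (by decide)
    refine HaltsIn.seq ((haltsIn_findProg hd₁ hD₁
      (exists_isMergeable hP hc (by omega))).mono le_rfl ?_)
    rintro m₂ ⟨⟨a, b, hab, ha, hb⟩, h₂⟩
    have ⟨haD, hbD, hne, _⟩ := hab
    have hdisj : ∀ X ∈ L₁ b, ∀ Z ∈ L₁ a, Disjoint X Z := fun X hX Z hZ =>
      Finset.disjoint_of_subset_left (hS.subset b hbD X hX)
        (Finset.disjoint_of_subset_right (hS.subset a haD Z hZ) (hS.disjoint b hbD a haD hne.symm))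
    refine (haltsIn_mergeProg (hd₁.congr h₂ (by decide)) (hD₁.congr h₂ (by decide))
      (hL₁.congr h₂ (by decide)) hne ha hb hdisj (hS.ne_nil haD) hlen).mono le_rfl ?_
    rintro m₃ ⟨⟨l', hl', hmerge, hL₃⟩, hD₃, h₃⟩
    have h₄ : AgreeOff {roundR} m₃ (m₃.set roundR 0 (k + 1)) :=
      (AgreeOff.refl _ _).set (by decide) _ _
    refine ⟨by rw [h₃ roundR (by decide), h₂ roundR (by decide), hr], ?_, D.erase a, _, _, ?_,
      hD₃.congr h₄ (by decide), hS.merge hab hmerge, hL₃.congr h₄ (by decide),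
      ⟨b, Finset.mem_erase.2 ⟨hne.symm, hbD⟩, ?_⟩, fun d => ?_⟩
    · exact h₁.trans ((h₂.mono (by decide)).trans ((h₃.mono (by decide)).trans
        (h₄.mono (by decide))))
    · rw [Finset.card_erase_of_mem haD, hcard]
      omega
    · rw [h₄ intoR (by decide), h₃ intoR (by decide), hb]
    · by_cases hdb : d = b
      · subst hdb
        rw [Function.update_self, hl']
        exact hlen d
      · rw [Function.update_of_ne hdb]
        exact hlen d
  · rintro m' - ⟨h, D, U, L', hcard, -, hS, hL', ⟨r, hrD, hr⟩, hlen⟩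
    obtain ⟨r', rfl⟩ := Finset.card_eq_one.1 (show D.card = 1 by omega)
    obtain rfl : r = r' := by simpa using hrD
    exact ⟨⟨r, U, L', hS, hL', hr, hlen r⟩, h⟩

/-- The program that computes a maximum cut. -/
def maxCutProg : Program :=
  .seq powersProg <| .seq twinsProg <| .seq buildProg <| .seq roundsProg <|
  .seq (setReg fromR (reg intoR)) <| .seq (setReg baseR (.const 0)) <| .seq argmaxProg <|
  forLoop vR (reg 0) (.write outA (reg vR) (bitE (reg bestSetR) (reg vR)))

/-- A bound for the number of elementary steps of `maxCutProg`, if the lists have length at most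
`N`. -/
def maxCutCost (n N : ℕ) : ℕ :=
  (3 * n + 3) + ((n * (n * (3 * n + 6) + 4) + 2) + ((n * (N * (2 * canonicalCost n + 16) + 11) + 4)
    + (roundsCost n N + (1 + (1 + ((N * (3 * n ^ 2 + 4 * n + 9) + 3) + (n * (1 + 2) + 2)))))))

theorem hasInput_inputMemory (G : SimpleGraph (Fin n)) (c : Fin n → Fin n) :
    HasInput G c (inputMemory G c) := by
  refine ⟨rfl, fun u v => ?_, fun u => ?_⟩
  · have : (∃ u' v' : Fin n, G.Adj u' v' ∧ u.val * n + v.val = u'.val * n + v'.val) ↔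
        G.Adj u v := by
      constructor
      · rintro ⟨u', v', h, he⟩
        obtain ⟨h1, rfl⟩ := mul_add_inj he
        rwa [Fin.ext h1]
      · exact fun h => ⟨u, v, h, rfl⟩
    simp only [inputMemory, ind]
    split_ifs with h1 h2 h2
    exacts [rfl, absurd (this.1 h1) h2, absurd (this.2 h2) h1, rfl]
  · simp [inputMemory]

theorem bounded_inputMemory (G : SimpleGraph (Fin n)) (c : Fin n → Fin n) :
    Bounded (maxEntry n) (inputMemory G c) := by
  have h1 : 1 ≤ maxEntry n := Nat.one_le_two_pow
  have h2 := le_maxEntry n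
  intro a i
  unfold inputMemory
  split
  · split_ifs <;> omega
  · split_ifs <;> omega
  · split_ifs with h
    · have := (c ⟨i, h⟩).2
      omega
    · omega
  · omega

theorem haltsIn_maxCutProg (hP : IsBubblePartition G P) (hc : IsLabelling P c) (hn : 0 < n) :
    HaltsIn (maxEntry n) maxCutProg (inputMemory G c) (maxCutCost n (stateBound G P)) fun m' =>
      ∃ S, IsOutput m' S ∧ ∀ S', cutValue G S' ≤ cutValue G S := by
  have hn' := le_maxEntry n
  have hinput := hasInput_inputMemory G c
  refine HaltsIn.seq ((haltsIn_powersProg hinput).mono le_rfl ?_)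
  rintro m₁ ⟨hpow, h₁⟩
  refine HaltsIn.seq ((haltsIn_twinsProg (hinput.congr h₁ (by decide))).mono le_rfl ?_)
  rintro m₂ ⟨htwin, h₂⟩
  have hd₂ : HasData G c m₂ := by
    refine ⟨(hinput.congr h₁ (by decide)).congr h₂ (by decide), ?_, htwin⟩
    intro u
    rw [h₂ powA (by decide), hpow u]
  refine HaltsIn.seq ((haltsIn_buildProg hP hc hd₂ fun i => ?_).mono le_rfl ?_)
  · rw [h₂ listA (by decide), h₁ listA (by decide)]
    rfl
  rintro m₃ ⟨⟨L, hL, hLm⟩, h₃⟩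
  have hd₃ := hd₂.congr h₃ (by decide)
  refine HaltsIn.seq ((haltsIn_roundsProg hP hc hd₃ hn (fun a => ?_) hL hLm ?_).mono le_rfl ?_)
  · rw [h₃ deadA (by decide), h₂ deadA (by decide), h₁ deadA (by decide)]
    simp [inputMemory, ind]
  · rw [h₃ intoR (by decide), h₂ intoR (by decide), h₁ intoR (by decide)]
    rfl
  rintro m₄ ⟨⟨r, U, L', hS, hL', hr, hlen, hlen'⟩, h₄⟩
  have hd₄ := hd₃.congr h₄ (by decide)
  refine HaltsIn.seq (HaltsIn.write ?_ (HaltsIn.seq (HaltsIn.write ?_ ?_)))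
  · simp only [Expr.eval, hr]
    have := r.2
    omega
  · simp [Expr.eval]
  simp only [Expr.eval, hr]
  set m₅ := (m₄.set fromR 0 r.val).set baseR 0 0
  have h₅ : AgreeOff {fromR, baseR} m₄ m₅ :=
    ((AgreeOff.refl _ _).set (by decide) _ _).set (by decide) _ _
  have hd₅ := hd₄.congr h₅ (by decide)
  have hfrom : m₅ fromR 0 = r.val := by
    rw [show m₅ fromR = m₄.set fromR 0 r.val fromR from Memory.set_of_ne _ (by decide) _ _,
      Memory.set_self]
  refine HaltsIn.seq ((haltsIn_argmaxProg hd₅ (hL'.congr h₅ (by decide)) hfrom (X := ∅)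
    (Memory.set_self _ _ _ _) (fun Z _ => Finset.disjoint_empty_left Z)
    (hS.ne_nil (Finset.mem_singleton_self r)) hlen').mono (by gcongr) ?_)
  rintro m₆ ⟨⟨X, hX, hcode, hmax⟩, h₆⟩
  simp only [Finset.empty_union] at hcode hmax
  have hd₆ := hd₅.congr h₆ (by decide)
  refine HaltsIn.forLoop (N := n) (fun k m' => AgreeOff {vR, outA} m₆ m' ∧
    ∀ v : Fin n, v.val < k → m' outA v.val = ind (v ∈ X)) hn' ?_ ?_ ?_ ?_
  · exact ⟨(AgreeOff.refl _ _).set (by decide) _ _, fun v h => absurd h (Nat.not_lt_zero _)⟩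
  · rintro k - m' ⟨h, -⟩ -
    simp only [Expr.eval, h 0 (by decide), hd₆.input.size]
  · rintro k hk m₇ hv ⟨h₇, hout⟩
    have e : (bitE (reg bestSetR) (reg vR)).eval m₇ = ind ((⟨k, hk⟩ : Fin n) ∈ X) :=
      eval_bitE (hd₆.congr h₇ (by decide)).powers
        (by simp only [Expr.eval, h₇ bestSetR (by decide), hcode]) hv
    refine HaltsIn.write ?_ ?_
    · rw [e]
      exact (ind_le_one _).trans Nat.one_le_two_pow
    rw [e]
    simp only [Expr.eval, hv]
    refine ⟨by rw [Memory.set_of_ne _ (by decide), hv],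
      (h₇.set (by decide) _ _).set (by decide) _ _, fun v hvk => ?_⟩
    rw [Memory.set_of_ne _ (by decide), Memory.set]
    split_ifs with h
    · rw [show v = ⟨k, hk⟩ from Fin.ext h.2]
    · exact hout v (by omega)
  · rintro m₇ - ⟨-, hout⟩
    refine ⟨X, fun v => ?_, hS.cutValue_le hmax⟩
    have := hout v v.2
    rw [show m₇ 3 v.val = m₇ outA v.val from rfl, this]
    unfold ind
    split_ifs <;> rfl

/-! ### The running time -/

theorem maxCutCost_le {n N : ℕ} (hN : 1 ≤ N) : maxCutCost n N ≤ maxCutCost n 1 * N ^ 2 := by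
  have h1 : N ≤ N ^ 2 := by nlinarith
  have h2 : 1 ≤ N ^ 2 := by nlinarith
  have key : ∀ a b d : ℕ, a + b * N + d * N ^ 2 ≤ (a + b + d) * N ^ 2 := by
    intro a b d
    nlinarith [Nat.mul_le_mul_left a h2, Nat.mul_le_mul_left b h1]
  have hsplit : ∀ N : ℕ, maxCutCost n N = maxCutCost n 0
      + (n * (2 * canonicalCost n + 16) + n * 7 + (3 * n ^ 2 + 4 * n + 9)) * N
      + (n * (3 * n ^ 2 + 4 * n + 9)) * N ^ 2 := by
    intro N
    unfold maxCutCost roundsCost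
    ring
  rw [hsplit N, hsplit 1]
  simpa using key _ _ _

theorem stateBound_sq_le (hn : 0 < n) : stateBound G P ^ 2
    ≤ 4 * (n ^ (4 * independenceNumber G P) * 4 ^ width G P) := by
  have h1 : 1 ≤ n ^ independenceNumber G P := Nat.one_le_pow _ _ hn
  have h2 : (n ^ independenceNumber G P + 1) ^ 2 ≤ 4 * n ^ (4 * independenceNumber G P) := by
    calc (n ^ independenceNumber G P + 1) ^ 2 ≤ (2 * n ^ independenceNumber G P) ^ 2 := by
          gcongr
          omega
      _ = 4 * n ^ (2 * independenceNumber G P) := by rw [mul_pow, ← pow_mul, mul_comm 2]; rfl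
      _ ≤ 4 * n ^ (4 * independenceNumber G P) := by
          gcongr
          norm_num
  calc stateBound G P ^ 2 = 4 ^ width G P * (n ^ independenceNumber G P + 1) ^ 2 := by
        rw [stateBound, mul_pow, ← pow_mul, mul_comm _ 2, pow_mul]; rfl
    _ ≤ 4 ^ width G P * (4 * n ^ (4 * independenceNumber G P)) := by gcongr
    _ = _ := by ring

open Polynomial in
/-- The polynomial factor of the running time. -/
noncomputable def timePolynomial : Polynomial ℕ :=
  C maxCutProg.weight * (4 * X + 6) * (4 * ((3 * X + 3) + ((X * (X * (3 * X + 6) + 4) + 2)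
    + ((X * ((2 * (3 * X ^ 4 + 4 * X ^ 3 + 4 * X ^ 2 + 4 * X + 3) + 16) + 11) + 4)
    + (X * (X * (X * (3 * X ^ 2 + 4 * X + 8) + 4) + ((3 * X ^ 2 + 4 * X + 9) + 7) + 7) + 2
    + (1 + (1 + ((3 * X ^ 2 + 4 * X + 9) + 3 + (X * 3 + 2)))))))))

theorem eval_timePolynomial (n : ℕ) :
    timePolynomial.eval n = maxCutProg.weight * (4 * n + 6) * (4 * maxCutCost n 1) := by
  simp [timePolynomial, maxCutCost]

theorem pos_of_isBubblePartition (hP : IsBubblePartition G P) : 0 < n := by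
  obtain ⟨A, hA⟩ := hP.2.connected.nonempty
  obtain ⟨u, -⟩ := P.nonempty_of_mem_parts hA
  exact u.pos

end BubbleCut

theorem mainTheorem1 :
    ∃ (prog : RAM.Program) (poly : Polynomial ℕ),
      ∀ (n : ℕ) (G : SimpleGraph (Fin n)) (P : Finpartition (Finset.univ : Finset (Fin n)))
        (c : Fin n → Fin n),
        BubbleCut.IsBubblePartition G P → BubbleCut.IsLabelling P c →
          ∃ (m : RAM.Memory) (t : ℕ) (S : Finset (Fin n)),
            RAM.Runs prog (BubbleCut.inputMemory G c) m t ∧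
            BubbleCut.IsOutput m S ∧
            BubbleCut.IsMaximumCut G S ∧
            t ≤ poly.eval n *
              (n ^ (4 * BubbleCut.independenceNumber G P) * 4 ^ BubbleCut.width G P) := by
  refine ⟨BubbleCut.maxCutProg, BubbleCut.timePolynomial, fun n G P c hP hc => ?_⟩
  have hn := BubbleCut.pos_of_isBubblePartition hP
  obtain ⟨m, t, hrun, ht, -, S, hout, hmax⟩ :=
    BubbleCut.haltsIn_maxCutProg hP hc hn (BubbleCut.bounded_inputMemory G c)
  refine ⟨m, t, S, hrun, hout, fun S' => ?_, ht.trans ?_⟩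
  · rw [← BubbleCut.cutValue_eq_cutSize, ← BubbleCut.cutValue_eq_cutSize]
    exact hmax S'
  · rw [Nat.size_pow, BubbleCut.eval_timePolynomial]
    have hpos : 1 ≤ BubbleCut.stateBound G P :=
      Nat.mul_pos (by positivity) (Nat.succ_pos _)
    calc BubbleCut.maxCutProg.weight * (4 * n + 4 + 1 + 1)
          * BubbleCut.maxCutCost n (BubbleCut.stateBound G P)
        ≤ BubbleCut.maxCutProg.weight * (4 * n + 6)
          * (BubbleCut.maxCutCost n 1 * BubbleCut.stateBound G P ^ 2) := by
          gcongr
          exact BubbleCut.maxCutCost_le hpos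
      _ ≤ BubbleCut.maxCutProg.weight * (4 * n + 6) * (BubbleCut.maxCutCost n 1
          * (4 * (n ^ (4 * BubbleCut.independenceNumber G P) * 4 ^ BubbleCut.width G P))) := by
          gcongr
          exact BubbleCut.stateBound_sq_le hn
      _ = _ := by ring
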